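/- Theorem 4.1. Let $0<I_1<I_2<I_3$ and $l>0$, and put $a=1/I_1$, $b=1/I_2$, $c=1/I_3$. On the sphere $\frac12(p_1^2+p_2^2+p_3^2)=l$ in $\mathbb{R}^3$ consider the Hamiltonian of the free rigid body $$H=\tfrac12\left(\frac{p_1^2}{I_1}+\frac{p_2^2}{I_2}+\frac{p_3^2}{I_3}\right)$$ and the symplectic form, normalized as $$\omega=\frac{dp_1\wedge dp_2}{3p_3}=\frac{dp_2\wedge dp_3}{3p_1}=\frac{dp_3\wedge dp_1}{3p_2}.$$ Let $P_0$ be one of the two elliptic equilibria $(\pm\sqrt{2l},0,0)$. A Birkhoff normal form of $H$ at $P_0$ is a function $\mathcal{H}_1$ of one real variable, analytic near $0$ with $\mathcal{H}_1'(0)\neq 0$, such that in some real analytic local coordinates $(x,y)$ on the sphere, centred at $P_0$ and with $\omega=dx\wedge dy$, one has $H=\mathcal{H}_1\left(\frac{x^2+y^2}{2}\right)$ near $P_0$; in particular $\mathcal{H}_1(0)=H(P_0)=l/I_1$. Such a normal form exists. If $\Phi_1$ denotes the local inverse of $\mathcal{H}_1$ near $l/I_1$ (so $\Phi_1(l/I_1)=0$),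 then for all real $h$ in a neighbourhood of $l/I_1$ the function $\Phi_1$ is differentiable at $h$ and, with $d=h/l$, $$\Phi_1'(h)=-\frac{1}{3\pi}\sqrt{\frac{2}{l}}\,\frac{1}{\sqrt{(d-c)(a-b)}}\,\mathcal{K}\!\left(\frac{(d-a)(b-c)}{(d-c)(b-a)}\right)=:S(a,b,c,d),$$ where $\mathcal{K}(\lambda)=\int_0^1\frac{dx}{\sqrt{(1-x^2)(1-\lambda x^2)}}$ is the complete elliptic integral of the first kind. -/

import Mathlib

open Filter Topology
open scoped Matrix

noncomputable section

namespace FreeRigidBody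

/-- Half the squared norm of the angular momentum `P = (p₁, p₂, p₃)`. The reduced phase space
(coadjoint orbit) is the level set `casimir P = l`, a sphere of radius `√(2l)`. -/
def casimir (P : Fin 3 → ℝ) : ℝ := (P 0 ^ 2 + P 1 ^ 2 + P 2 ^ 2) / 2

/-- The Hamiltonian of the free rigid body with principal moments of inertia `I₁, I₂, I₃`. -/
def energy (I₁ I₂ I₃ : ℝ) (P : Fin 3 → ℝ) : ℝ :=
  (P 0 ^ 2 / I₁ + P 1 ^ 2 / I₂ + P 2 ^ 2 / I₃) / 2

/-- The symplectic form on the spheres centred at the origin, evaluated on vectors `u`, `v`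
tangent at `P`, with the normalization
`ω = dp₁ ∧ dp₂ / (3 p₃) = dp₂ ∧ dp₃ / (3 p₁) = dp₃ ∧ dp₁ / (3 p₂)`.
The three coordinate expressions are the lemmas `orbitForm_eq₁`, `orbitForm_eq₂`,
`orbitForm_eq₃` below. -/
def orbitForm (P u v : Fin 3 → ℝ) : ℝ := (P ⬝ᵥ (u ⨯₃ v)) / (3 * (P ⬝ᵥ P))

lemma dotProduct_self_ne_zero (P : Fin 3 → ℝ) (i : Fin 3) (h : P i ≠ 0) : P ⬝ᵥ P ≠ 0 := by
  intro h0
  exact h (congrFun (dotProduct_self_eq_zero.mp h0) i)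

lemma orbitForm_eq₁ (P u v : Fin 3 → ℝ) (hu : P ⬝ᵥ u = 0) (hv : P ⬝ᵥ v = 0) (h : P 0 ≠ 0) :
    orbitForm P u v = (u 1 * v 2 - u 2 * v 1) / (3 * P 0) := by
  have hP := dotProduct_self_ne_zero P 0 h
  rw [orbitForm, div_eq_div_iff (by positivity) (by positivity)]
  simp [dotProduct, Fin.sum_univ_three, cross_apply] at hu hv ⊢
  linear_combination (3 * P 2 * v 1 - 3 * P 1 * v 2) * hu
    + (3 * P 1 * u 2 - 3 * P 2 * u 1) * hv

lemma orbitForm_eq₂ (P u v : Fin 3 → ℝ) (hu : P ⬝ᵥ u = 0) (hv : P ⬝ᵥ v = 0) (h : P 1 ≠ 0) :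
    orbitForm P u v = (u 2 * v 0 - u 0 * v 2) / (3 * P 1) := by
  have hP := dotProduct_self_ne_zero P 1 h
  rw [orbitForm, div_eq_div_iff (by positivity) (by positivity)]
  simp [dotProduct, Fin.sum_univ_three, cross_apply] at hu hv ⊢
  linear_combination (3 * P 0 * v 2 - 3 * P 2 * v 0) * hu
    + (3 * P 2 * u 0 - 3 * P 0 * u 2) * hv

lemma orbitForm_eq₃ (P u v : Fin 3 → ℝ) (hu : P ⬝ᵥ u = 0) (hv : P ⬝ᵥ v = 0) (h : P 2 ≠ 0) :
    orbitForm P u v = (u 0 * v 1 - u 1 * v 0) / (3 * P 2) := by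
  have hP := dotProduct_self_ne_zero P 2 h
  rw [orbitForm, div_eq_div_iff (by positivity) (by positivity)]
  simp [dotProduct, Fin.sum_univ_three, cross_apply] at hu hv ⊢
  linear_combination (3 * P 1 * v 0 - 3 * P 0 * v 1) * hu
    + (3 * P 0 * u 1 - 3 * P 1 * u 0) * hv

/-- `ψ` is (the inverse of) an analytic Darboux chart `(x, y)` of the sphere `casimir = l`,
centred at `P₀`: it parametrizes the sphere near `P₀` and `ψ^* ω = dx ∧ dy`. The last
condition forces `ψ` to be an immersion, hence a local diffeomorphism onto the sphere. -/
structure IsDarbouxChart (l : ℝ) (P₀ : Fin 3 → ℝ) (ψ : ℝ × ℝ → Fin 3 → ℝ) : Prop where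
  analyticAt : AnalyticAt ℝ ψ 0
  map_zero : ψ 0 = P₀
  mem_orbit : ∀ᶠ z in 𝓝 (0 : ℝ × ℝ), casimir (ψ z) = l
  pullback_form : ∀ᶠ z in 𝓝 (0 : ℝ × ℝ),
    orbitForm (ψ z) (fderiv ℝ ψ z (1, 0)) (fderiv ℝ ψ z (0, 1)) = 1

/-- `N` is a (convergent) Birkhoff normal form, at the elliptic equilibrium `P₀`, of the function
`H` on the sphere `casimir = l`: `N` is analytic and invertible around `0`, and in a suitable
analytic Darboux chart centred at `P₀` one has `H = N ((x² + y²) / 2)`. The constant term of `N`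
is the value `H P₀`. -/
structure IsBirkhoffNormalForm (l : ℝ) (H : (Fin 3 → ℝ) → ℝ) (P₀ : Fin 3 → ℝ) (N : ℝ → ℝ) :
    Prop where
  analyticAt : AnalyticAt ℝ N 0
  deriv_ne_zero : deriv N 0 ≠ 0
  exists_chart : ∃ ψ : ℝ × ℝ → Fin 3 → ℝ, IsDarbouxChart l P₀ ψ ∧
    ∀ᶠ z in 𝓝 (0 : ℝ × ℝ), H (ψ z) = N ((z.1 ^ 2 + z.2 ^ 2) / 2)

/-- `Φ` is an inverse Birkhoff normal form of `H` at `P₀`: a local inverse, near the critical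
value `N 0 = H P₀`, of a Birkhoff normal form `N` of `H` at `P₀`. -/
def IsInverseBirkhoffNormalForm (l : ℝ) (H : (Fin 3 → ℝ) → ℝ) (P₀ : Fin 3 → ℝ) (Φ : ℝ → ℝ) :
    Prop :=
  ∃ N : ℝ → ℝ, IsBirkhoffNormalForm l H P₀ N ∧
    (∀ᶠ t in 𝓝 (0 : ℝ), Φ (N t) = t) ∧ ∀ᶠ h in 𝓝 (N 0), N (Φ h) = h

/-- The complete elliptic integral of the first kind, as a function of the parameter `lam = k²`. -/
def ellipticK (lam : ℝ) : ℝ :=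
  ∫ x in (0 : ℝ)..1, 1 / √((1 - x ^ 2) * (1 - lam * x ^ 2))

/-- The defining integral of `ellipticK lam` converges for `lam < 1`. -/
lemma intervalIntegrable_ellipticK (lam : ℝ) (hlam : lam < 1) :
    IntervalIntegrable (fun x : ℝ => 1 / √((1 - x ^ 2) * (1 - lam * x ^ 2)))
      MeasureTheory.volume 0 1 := by
  have h1 : IntervalIntegrable (fun x : ℝ => (1 - x) ^ (-(1 / 2) : ℝ))
      MeasureTheory.volume 0 1 := by
    have := (intervalIntegral.intervalIntegrable_rpow' (a := 1) (b := 0)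
      (r := (-(1 / 2) : ℝ)) (by norm_num)).comp_sub_left 1
    simpa using this
  have h2 : ContinuousOn (fun x : ℝ => 1 / √((1 + x) * (1 - lam * x ^ 2)))
      (Set.uIcc (0 : ℝ) 1) := by
    refine ContinuousOn.div (by fun_prop) (by fun_prop) ?_
    intro x hx
    rw [Set.uIcc_of_le zero_le_one] at hx
    have hx2 : x ^ 2 ≤ 1 := pow_le_one₀ hx.1 hx.2
    have : 0 < 1 - lam * x ^ 2 := by
      rcases le_or_gt lam 0 with h0 | h0
      · nlinarith [sq_nonneg x]
      · nlinarith [mul_le_mul_of_nonneg_left hx2 h0.le]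
    have : 0 < 1 + x := by linarith [hx.1]
    positivity
  refine (h1.mul_continuousOn h2).congr ?_
  intro x hx
  rw [Set.uIoc_of_le zero_le_one] at hx
  have h3 : 0 ≤ 1 - x := by linarith [hx.2]
  simp only
  rw [Real.rpow_neg h3, ← Real.sqrt_eq_rpow,
    show (1 - x ^ 2) * (1 - lam * x ^ 2) = (1 - x) * ((1 + x) * (1 - lam * x ^ 2)) by ring,
    Real.sqrt_mul h3, one_div, one_div, mul_inv]

/-- The function `S(a, b, c, d)` attached to the sphere `casimir = l`. -/
def periodS (l a b c d : ℝ) : ℝ :=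
  -(1 / (3 * Real.pi)) * √(2 / l) * (1 / √((d - c) * (a - b))) *
    ellipticK ((d - a) * (b - c) / ((d - c) * (b - a)))

end FreeRigidBody

end

/-!
The coordinates `(√(a - b) p₂, √(a - c) p₃)` on the hemisphere around `P₀` turn `l a - H` into half
the squared norm and `ω` into an area form with analytic density `f`. A twist
`z ↦ √(J (|z|² / 2)) • e^{i g(z)} z` preserves the family of circles centred at the origin; with
`J` chosen from the mean of `f` over these circles and `g` from its oscillation along them, the
twist takes `f dx ∧ dy` to `dx ∧ dy`. The action `I` of a circle satisfies `I' =` (mean of `f` over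
that circle), and this gives a normal form with inverse `h ↦ I (l a - h)`.

Two Darboux charts in which `H` depends on the circle only differ by an area-preserving map that
takes circles to circles. Such a map turns the circle of action `s` at a constant rate
`1 / χ'(s)`, where `χ` is its effect on actions; the rate is an integer close to `1`, so the map
preserves the action and every inverse normal form has the same derivative. Finally the circular
mean of `f` is a complete elliptic integral, and the antipodal map carries one equilibrium to the
other.
-/

namespace FreeRigidBody

section Analytic

open MeasureTheory

variable {E E' F G : Type*} [NormedAddCommGroup E] [NormedSpace ℝ E]
  [NormedAddCommGroup E'] [NormedSpace ℝ E'] [NormedAddCommGroup F] [NormedSpace ℝ F]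
  [NormedAddCommGroup G] [NormedSpace ℝ G]

lemma hasFPowerSeriesOnBall_integral [CompleteSpace G] {α : Type*} [MeasurableSpace α]
    {μ : Measure α} [IsFiniteMeasure μ] {f : α → E → G}
    {p : α → FormalMultilinearSeries ℝ E G} {x : E} {r : NNReal} {C : ℝ} (hr : 0 < r)
    (hp : ∀ n, AEStronglyMeasurable (fun t => p t n) μ)
    (hC : ∀ᵐ t ∂μ, ∀ n, ‖p t n‖ * (r : ℝ) ^ n ≤ C)
    (hf : ∀ᵐ t ∂μ, HasFPowerSeriesOnBall (f t) (p t) x r) :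
    HasFPowerSeriesOnBall (fun y => ∫ t, f t y ∂μ) (fun n => ∫ t, p t n ∂μ) x r := by
  have hr' : (0 : ℝ) < r := hr
  have hbound : ∀ᵐ t ∂μ, ∀ n, ‖p t n‖ ≤ C / (r : ℝ) ^ n :=
    hC.mono fun t ht n => (le_div_iff₀ (by positivity)).2 (ht n)
  have hint : ∀ n, Integrable (fun t => p t n) μ := fun n =>
    .of_bound (hp n) _ (hbound.mono fun t ht => ht n)
  refine ⟨?_, by exact_mod_cast hr, fun {y} hy => ?_⟩
  · refine FormalMultilinearSeries.le_radius_of_bound _ (C * μ.real Set.univ) fun n => ?_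
    rw [← le_div_iff₀ (by positivity), mul_div_right_comm]
    exact norm_integral_le_of_norm_le_const (hbound.mono fun t ht => ht n)
  · have hy' : ‖y‖ / r < 1 := by
      rw [Metric.mem_eball, edist_zero_right, enorm_lt_coe] at hy
      exact (div_lt_one hr').2 hy
    have happly : ∀ n, (∫ t, p t n ∂μ) (fun _ => y) = ∫ t, p t n (fun _ => y) ∂μ := fun n =>
      ((ContinuousMultilinearMap.apply ℝ (fun _ : Fin n => E) G fun _ => y).integral_comp_comm
        (hint n)).symm
    simp only [happly]
    refine hasSum_integral_of_dominated_convergence (fun n _ => C * (‖y‖ / r) ^ n)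
      (fun n => ((ContinuousMultilinearMap.apply ℝ (fun _ : Fin n => E) G
        fun _ => y).integrable_comp (hint n)).aestronglyMeasurable)
      (fun n => hbound.mono fun t ht => ?_)
      (Eventually.of_forall fun _ => (summable_geometric_of_lt_one (by positivity) hy').mul_left C)
      (integrable_const _) (hf.mono fun _ ht => ht.hasSum hy)
    calc ‖p t n fun _ => y‖ ≤ ‖p t n‖ * ‖y‖ ^ n := by
          simpa using (p t n).le_opNorm fun _ => y
      _ ≤ C / (r : ℝ) ^ n * ‖y‖ ^ n := by gcongr; exact ht n
      _ = C * (‖y‖ / r) ^ n := by rw [div_pow]; ring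

lemma norm_compContinuousLinearMap_mul_pow_le {p : FormalMultilinearSeries ℝ E G}
    {L : E' →L[ℝ] E} {K ρ : NNReal} {C : ℝ} (hK : 0 < K) (hL : ‖L‖ ≤ K)
    (hC : ∀ n, ‖p n‖ * (ρ : ℝ) ^ n ≤ C) (n : ℕ) :
    ‖p.compContinuousLinearMap L n‖ * ((ρ / K : NNReal) : ℝ) ^ n ≤ C := by
  calc ‖p.compContinuousLinearMap L n‖ * ((ρ / K : NNReal) : ℝ) ^ n
      ≤ ‖p n‖ * (K : ℝ) ^ n * (ρ / K : ℝ) ^ n := by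
        rw [NNReal.coe_div]
        gcongr
        exact (p.norm_compContinuousLinearMap_le L n).trans (by gcongr)
    _ = ‖p n‖ * (ρ : ℝ) ^ n := by
        rw [mul_assoc, ← mul_pow, mul_div_cancel₀ _ (NNReal.coe_ne_zero.2 hK.ne')]
    _ ≤ C := hC n

lemma hasFPowerSeriesOnBall_comp_clm {f : E → G} {p : FormalMultilinearSeries ℝ E G}
    {ε : ENNReal} (hf : HasFPowerSeriesOnBall f p 0 ε) {L : E' →L[ℝ] E} {K ρ : NNReal}
    (hK : 0 < K) (hL : ‖L‖ ≤ K) (hρ : 0 < ρ) (hρε : ρ ≤ ε) :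
    HasFPowerSeriesOnBall (f ∘ L) (p.compContinuousLinearMap L) 0 (ρ / K : NNReal) := by
  have hfL : HasFPowerSeriesOnBall f p (L 0) ε := by rwa [map_zero]
  refine hfL.compContinuousLinearMap.mono (by simp [hρ, hK]) ?_
  rw [ENNReal.coe_div hK.ne']
  exact ENNReal.div_le_div hρε (ENNReal.coe_le_coe.2 hL)

lemma analyticAt_intervalIntegral_comp_clm [CompleteSpace G] {f : E → G} (hf : AnalyticAt ℝ f 0)
    {L : ℝ → E' →L[ℝ] E} (hL : Continuous L) {w : ℝ → ℝ} (hw : Continuous w) (a b : ℝ) :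
    AnalyticAt ℝ (fun x => ∫ t in a..b, w t • f (L t x)) 0 := by
  obtain ⟨p, ε, hp⟩ := hf
  obtain ⟨ρ, hρ, hρε⟩ : ∃ ρ : NNReal, 0 < ρ ∧ (ρ : ENNReal) < ε := by
    simpa using ENNReal.lt_iff_exists_nnreal_btwn.1 hp.r_pos
  obtain ⟨C, -, hC⟩ := p.norm_mul_pow_le_of_lt_radius (hρε.trans_le hp.r_le)
  obtain ⟨K, hK0, hK⟩ : ∃ K : NNReal, 0 < K ∧ ∀ t ∈ Set.uIcc a b, ‖L t‖ ≤ K := by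
    obtain ⟨K, hK⟩ := isCompact_uIcc.exists_bound_of_continuousOn hL.continuousOn
    exact ⟨max K.toNNReal 1, by simp, fun t ht => (hK t ht).trans (by simp)⟩
  obtain ⟨W, hW⟩ := isCompact_uIcc.exists_bound_of_continuousOn (s := Set.uIcc a b) hw.continuousOn
  let q : ℝ → FormalMultilinearSeries ℝ E' G := fun t => w t • p.compContinuousLinearMap (L t)
  have hq : ∀ n, Continuous fun t => q t n := fun n =>
    hw.smul (((ContinuousMultilinearMap.compContinuousLinearMapContinuousMultilinear ℝ
      (fun _ : Fin n => E') (fun _ : Fin n => E) G).cont.comp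
        (continuous_pi fun _ => hL)).clm_apply continuous_const)
  have hq_norm : ∀ t ∈ Set.uIcc a b, ∀ n, ‖q t n‖ * ((ρ / K : NNReal) : ℝ) ^ n ≤ W * C := by
    intro t ht n
    have hqn : ‖q t n‖ = ‖w t‖ * ‖p.compContinuousLinearMap (L t) n‖ :=
      norm_smul (w t) (p.compContinuousLinearMap (L t) n)
    rw [hqn, mul_assoc]
    exact mul_le_mul (hW t ht) (norm_compContinuousLinearMap_mul_pow_le hK0 (hK t ht) hC n)
      (by positivity) ((norm_nonneg _).trans (hW t ht))
  have hq_series : ∀ t ∈ Set.uIcc a b,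
      HasFPowerSeriesOnBall (fun x => w t • f (L t x)) (q t) 0 (ρ / K : NNReal) := fun t ht =>
    (hasFPowerSeriesOnBall_comp_clm hp hK0 (hK t ht) hρ hρε.le).const_smul
  have hae : ∀ᵐ t ∂volume.restrict (Set.uIoc a b), t ∈ Set.uIcc a b :=
    (ae_restrict_mem measurableSet_uIoc).mono fun t ht => Set.uIoc_subset_uIcc ht
  have hfin : IsFiniteMeasure (volume.restrict (Set.uIoc a b)) :=
    inferInstanceAs (IsFiniteMeasure (volume.restrict (Set.Ioc _ _)))
  have hseries := hasFPowerSeriesOnBall_integral (div_pos hρ hK0)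
    (fun n => (hq n).aestronglyMeasurable) (hae.mono hq_norm) (hae.mono hq_series)
  simp only [intervalIntegral.intervalIntegral_eq_integral_uIoc]
  exact hseries.analyticAt.const_smul

lemma exists_analyticAt_localInverse [CompleteSpace E] [CompleteSpace F] {f : E → F} {x : E}
    (hf : AnalyticAt ℝ f x) {f' : E ≃L[ℝ] F} (hf' : HasFDerivAt f (f' : E →L[ℝ] F) x) :
    ∃ g : F → E, AnalyticAt ℝ g (f x) ∧ g (f x) = x ∧ (∀ᶠ y in 𝓝 (f x), f (g y) = y) ∧
      ∀ᶠ z in 𝓝 x, g (f z) = z := by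
  have hc : ContDiffAt ℝ ⊤ f x := hf.contDiffAt
  have hs := hc.hasStrictFDerivAt' hf' (by simp)
  exact ⟨hc.localInverse hf' (by simp), (hc.to_localInverse hf' (by simp)).analyticAt,
    hc.localInverse_apply_image hf' (by simp), hs.eventually_right_inverse,
    hs.eventually_left_inverse⟩

lemma exists_analyticAt_localInverse_of_det_ne_zero [FiniteDimensional ℝ E] {f : E → E} {x : E}
    (hf : AnalyticAt ℝ f x) (hdet : (fderiv ℝ f x).det ≠ 0) :
    ∃ g : E → E, AnalyticAt ℝ g (f x) ∧ g (f x) = x ∧ (∀ᶠ y in 𝓝 (f x), f (g y) = y) ∧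
      ∀ᶠ z in 𝓝 x, g (f z) = z := by
  have : CompleteSpace E := FiniteDimensional.complete ℝ E
  refine exists_analyticAt_localInverse hf
    (f' := (fderiv ℝ f x).toContinuousLinearEquivOfDetNeZero hdet) ?_
  rw [ContinuousLinearMap.coe_toContinuousLinearEquivOfDetNeZero]
  exact hf.differentiableAt.hasFDerivAt

lemma exists_analyticAt_localInverse_of_deriv_ne_zero {f : ℝ → ℝ} {x : ℝ}
    (hf : AnalyticAt ℝ f x) (hf' : deriv f x ≠ 0) :
    ∃ g : ℝ → ℝ, AnalyticAt ℝ g (f x) ∧ g (f x) = x ∧ (∀ᶠ y in 𝓝 (f x), f (g y) = y) ∧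
      ∀ᶠ z in 𝓝 x, g (f z) = z :=
  exists_analyticAt_localInverse hf
    (hf.differentiableAt.hasDerivAt.hasFDerivAt_equiv hf')

lemma exists_analyticAt_average {M : ℝ → ℝ} (hM : AnalyticAt ℝ M 0) :
    ∃ J : ℝ → ℝ, AnalyticAt ℝ J 0 ∧ J 0 = M 0 ∧
      ∀ᶠ s in 𝓝 0, HasDerivAt (fun s => s * J s) (M s) s := by
  refine ⟨fun s => ∫ t in (0 : ℝ)..1, M (t * s), ?_, by simp, ?_⟩
  · simpa using analyticAt_intervalIntegral_comp_clm hM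
      (L := fun t : ℝ => t • ContinuousLinearMap.id ℝ ℝ) (by fun_prop)
      (w := fun _ => 1) continuous_const 0 1
  obtain ⟨ε, hε, h⟩ := Metric.eventually_nhds_iff_ball.1 hM.eventually_analyticAt
  filter_upwards [Metric.ball_mem_nhds _ hε] with s hs
  have heq : (fun s => s * ∫ t in (0 : ℝ)..1, M (t * s)) = fun s => ∫ t in (0 : ℝ)..s, M t := by
    funext s
    simp
  have hcont : ContinuousOn M (Metric.ball 0 ε) :=
    fun x hx => (h x hx).continuousAt.continuousWithinAt
  have hsub : Set.uIcc 0 s ⊆ Metric.ball (0 : ℝ) ε :=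
    (convex_ball (0 : ℝ) ε).ordConnected.uIcc_subset (Metric.mem_ball_self hε) hs
  rw [heq]
  exact intervalIntegral.integral_hasDerivAt_right (hcont.mono hsub).intervalIntegrable
    (hcont.stronglyMeasurableAtFilter Metric.isOpen_ball s hs) (h s hs).continuousAt

lemma analyticAt_sqrt {x : ℝ} (hx : x ≠ 0) : AnalyticAt ℝ Real.sqrt x :=
  (Real.contDiffAt_sqrt hx (n := ⊤)).analyticAt

end Analytic

section Rotation

/-- Rotation of the plane by a right angle, i.e. multiplication by `i`; `z ↦ quarterTurn z` is the
angular vector field. -/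
noncomputable def quarterTurn : ℝ × ℝ →L[ℝ] ℝ × ℝ :=
  (-ContinuousLinearMap.snd ℝ ℝ ℝ).prod (ContinuousLinearMap.fst ℝ ℝ ℝ)

lemma quarterTurn_apply (z : ℝ × ℝ) : quarterTurn z = (-z.2, z.1) := rfl

/-- Rotation of the plane by the angle `t`. -/
noncomputable def rot (t : ℝ) : ℝ × ℝ →L[ℝ] ℝ × ℝ :=
  Real.cos t • ContinuousLinearMap.id ℝ (ℝ × ℝ) + Real.sin t • quarterTurn

lemma rot_apply (t : ℝ) (z : ℝ × ℝ) :
    rot t z = (Real.cos t * z.1 - Real.sin t * z.2, Real.cos t * z.2 + Real.sin t * z.1) := by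
  simp [rot, quarterTurn_apply, Prod.ext_iff, sub_eq_add_neg]

@[simp]
lemma rot_zero : rot 0 = ContinuousLinearMap.id ℝ (ℝ × ℝ) := by simp [rot]

lemma rot_rot (s t : ℝ) (z : ℝ × ℝ) : rot s (rot t z) = rot (s + t) z := by
  simp only [rot_apply, Real.cos_add, Real.sin_add, Prod.mk.injEq]
  constructor <;> ring

lemma quarterTurn_rot (t : ℝ) (z : ℝ × ℝ) : quarterTurn (rot t z) = rot t (quarterTurn z) := by
  simp only [rot_apply, quarterTurn_apply, Prod.mk.injEq]
  constructor <;> ring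

lemma rot_periodic : Function.Periodic rot (2 * Real.pi) := fun t => by simp [rot]

lemma hasDerivAt_rot (t : ℝ) : HasDerivAt rot (quarterTurn ∘L rot t) t := by
  have h := ((Real.hasDerivAt_cos t).smul_const (ContinuousLinearMap.id ℝ (ℝ × ℝ))).add
    ((Real.hasDerivAt_sin t).smul_const quarterTurn)
  refine h.congr_deriv (ContinuousLinearMap.ext fun z => ?_)
  simp only [rot_apply, quarterTurn_apply, Prod.ext_iff, ContinuousLinearMap.comp_apply,
    add_apply, smul_apply, ContinuousLinearMap.id_apply,
    Prod.fst_add, Prod.snd_add, Prod.smul_fst, Prod.smul_snd, smul_eq_mul]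
  constructor <;> ring

lemma continuous_rot : Continuous rot := by
  unfold rot
  fun_prop

lemma hasDerivAt_rot_apply (t : ℝ) (z : ℝ × ℝ) :
    HasDerivAt (fun t => rot t z) (quarterTurn (rot t z)) t := by
  simpa using (hasDerivAt_rot t).clm_apply (hasDerivAt_const t z)

lemma norm_rot_le (t : ℝ) : ‖rot t‖ ≤ 2 := by
  have hturn : ‖quarterTurn‖ ≤ 1 :=
    ContinuousLinearMap.opNorm_le_bound _ zero_le_one fun z => by
      simp [quarterTurn_apply, Prod.norm_def, max_comm]
  calc ‖rot t‖
      ≤ ‖Real.cos t‖ * ‖ContinuousLinearMap.id ℝ (ℝ × ℝ)‖ + ‖Real.sin t‖ * ‖quarterTurn‖ := by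
        rw [← norm_smul, ← norm_smul]
        exact norm_add_le _ _
    _ ≤ 1 * 1 + 1 * 1 := by
        gcongr
        exacts [Real.abs_cos_le_one t, ContinuousLinearMap.norm_id_le, Real.abs_sin_le_one t]
    _ = 2 := by norm_num

lemma eventually_forall_rot {p : ℝ × ℝ → Prop} (hp : ∀ᶠ z in 𝓝 0, p z) :
    ∀ᶠ z in 𝓝 (0 : ℝ × ℝ), ∀ t, p (rot t z) := by
  obtain ⟨ε, hε, h⟩ := Metric.eventually_nhds_iff.1 hp
  refine Metric.eventually_nhds_iff.2 ⟨ε / 2, by positivity, fun z hz t => h ?_⟩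
  rw [dist_zero_right] at hz ⊢
  linarith [(rot t).le_of_opNorm_le (norm_rot_le t) z]

lemma eq_rot_of_hasDerivAt {f : ℝ → ℝ × ℝ} {κ : ℝ}
    (hf : ∀ t, HasDerivAt f (κ • quarterTurn (f t)) t) (t : ℝ) : f t = rot (κ * t) (f 0) := by
  have hd : ∀ s, HasDerivAt (fun s => rot (-(κ * s)) (f s)) 0 s := by
    intro s
    have hrot := (hasDerivAt_rot (-(κ * s))).scomp s ((hasDerivAt_id s).const_mul κ).neg
    refine (hrot.clm_apply (hf s)).congr_deriv ?_
    simp [quarterTurn_rot]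
  have hconst := is_const_of_deriv_eq_zero (fun s => (hd s).differentiableAt)
    (fun s => (hd s).deriv) t 0
  simpa [rot_rot] using congrArg (rot (κ * t)) hconst

/-- Half the squared Euclidean norm on the plane, the action of the harmonic oscillator. -/
noncomputable def halfSq (z : ℝ × ℝ) : ℝ := (z.1 ^ 2 + z.2 ^ 2) / 2

@[simp]
lemma halfSq_zero : halfSq 0 = 0 := by simp [halfSq]

lemma halfSq_smul (c : ℝ) (z : ℝ × ℝ) : halfSq (c • z) = c ^ 2 * halfSq z := by
  simp only [halfSq, Prod.smul_fst, Prod.smul_snd, smul_eq_mul]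
  ring

@[simp]
lemma halfSq_rot (t : ℝ) (z : ℝ × ℝ) : halfSq (rot t z) = halfSq z := by
  simp only [halfSq, rot_apply]
  linear_combination ((z.1 ^ 2 + z.2 ^ 2) / 2) * Real.sin_sq_add_cos_sq t

lemma analyticAt_halfSq (z : ℝ × ℝ) : AnalyticAt ℝ halfSq z := by
  unfold halfSq
  exact ((analyticAt_fst.pow 2).add (analyticAt_snd.pow 2)).div_const

lemma tendsto_halfSq : Tendsto halfSq (𝓝 0) (𝓝 0) := by
  simpa using (analyticAt_halfSq 0).continuousAt.tendsto

lemma fderiv_halfSq_apply (z v : ℝ × ℝ) : fderiv ℝ halfSq z v = z.1 * v.1 + z.2 * v.2 := by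
  have h := (((hasFDerivAt_fst (𝕜 := ℝ) (p := z)).pow 2).add
    ((hasFDerivAt_snd (𝕜 := ℝ) (p := z)).pow 2)).mul_const (1 / 2 : ℝ)
  have hd : HasFDerivAt halfSq _ z :=
    h.congr_of_eventuallyEq (Eventually.of_forall fun w => by simp [halfSq, div_eq_mul_inv])
  rw [hd.fderiv]
  simp only [smul_apply, add_apply,
    ContinuousLinearMap.coe_fst', ContinuousLinearMap.coe_snd', smul_eq_mul, nsmul_eq_mul]
  push_cast
  ring

lemma exists_eq_rot (z : ℝ × ℝ) : ∃ θ, z = rot θ (√(2 * halfSq z), 0) := by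
  let w : ℂ := ⟨z.1, z.2⟩
  have hw : √(2 * halfSq z) = ‖w‖ := by
    rw [Complex.norm_eq_sqrt_sq_add_sq, halfSq, mul_div_cancel₀ _ two_ne_zero]
  refine ⟨w.arg, ?_⟩
  simp only [rot_apply, hw, mul_zero, sub_zero, zero_add, mul_comm _ ‖w‖]
  exact Prod.ext (Complex.norm_mul_cos_arg w).symm (Complex.norm_mul_sin_arg w).symm

lemma det_clm_prod (L : ℝ × ℝ →L[ℝ] ℝ × ℝ) :
    L.det = (L (1, 0)).1 * (L (0, 1)).2 - (L (0, 1)).1 * (L (1, 0)).2 := by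
  rw [ContinuousLinearMap.det, ← LinearMap.det_toMatrix (Module.Basis.finTwoProd ℝ),
    Matrix.det_fin_two]
  simp [LinearMap.toMatrix_apply]

lemma det_rot (t : ℝ) : (rot t).det = 1 := by
  rw [det_clm_prod]
  simp only [rot_apply]
  linear_combination Real.sin_sq_add_cos_sq t

end Rotation

section AngularAverage

lemma hasDerivAt_integral_id_smul_comp_add {E : Type*} [NormedAddCommGroup E] [NormedSpace ℝ E]
    [CompleteSpace E] {f : ℝ → E} {T : ℝ} (hf : Continuous f) (hper : Function.Periodic f T)
    (τ : ℝ) :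
    HasDerivAt (fun τ => ∫ t in (0 : ℝ)..T, t • f (t + τ))
      (T • f τ - ∫ t in (0 : ℝ)..T, f t) τ := by
  have hk : Continuous fun t => t • f t := continuous_id.smul hf
  have hshift : (fun τ => ∫ t in (0 : ℝ)..T, t • f (t + τ)) = fun τ =>
      ((∫ t in (0 : ℝ)..τ + T, t • f t) - ∫ t in (0 : ℝ)..τ, t • f t) -
        τ • ∫ t in (0 : ℝ)..T, f t := by
    funext τ
    have hτ : Continuous fun t => τ • f t := hf.const_smul τ
    have hcov := intervalIntegral.integral_comp_add_right (a := 0) (b := T)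
      (fun t => (t - τ) • f t) τ
    simp only [add_sub_cancel_right, zero_add, add_comm T τ] at hcov
    rw [hcov]
    simp only [sub_smul]
    rw [intervalIntegral.integral_sub (hk.intervalIntegrable _ _)
        (hτ.intervalIntegrable _ _), intervalIntegral.integral_smul,
      hper.intervalIntegral_add_eq τ 0, zero_add,
      intervalIntegral.integral_interval_sub_left (hk.intervalIntegrable _ _)
        (hk.intervalIntegrable _ _)]
  have hupper := (hk.integral_hasStrictDerivAt 0 (τ + T)).hasDerivAt.comp_add_const τ T
  have hlower := (hk.integral_hasStrictDerivAt 0 τ).hasDerivAt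
  rw [hshift]
  refine ((hupper.sub hlower).sub
    ((hasDerivAt_id τ).smul_const (∫ t in (0 : ℝ)..T, f t))).congr_deriv ?_
  rw [hper τ, add_smul, add_sub_cancel_left, one_smul]

/-- The mean of `F` over the circle through `z` centred at the origin. -/
noncomputable def rotMean (F : ℝ × ℝ → ℝ) (z : ℝ × ℝ) : ℝ :=
  (2 * Real.pi)⁻¹ * ∫ t in (0 : ℝ)..2 * Real.pi, F (rot t z)

lemma rotMean_rot (F : ℝ × ℝ → ℝ) (θ : ℝ) (z : ℝ × ℝ) : rotMean F (rot θ z) = rotMean F z := by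
  have hper : Function.Periodic (fun t => F (rot t z)) (2 * Real.pi) := fun t =>
    congrArg (fun L : ℝ × ℝ →L[ℝ] ℝ × ℝ => F (L z)) (rot_periodic t)
  simp only [rotMean, rot_rot]
  rw [intervalIntegral.integral_comp_add_right fun t => F (rot t z), zero_add,
    add_comm (2 * Real.pi) θ, hper.intervalIntegral_add_eq θ 0, zero_add]

/-- Averaging `t F (rot t z)` over a period inverts the angular derivative on functions of mean
zero. -/
lemma exists_analyticAt_angular_primitive {F : ℝ × ℝ → ℝ} (hF : AnalyticAt ℝ F 0) :
    ∃ g : ℝ × ℝ → ℝ, AnalyticAt ℝ g 0 ∧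
      ∀ᶠ z in 𝓝 0, fderiv ℝ g z (quarterTurn z) = F z - rotMean F z := by
  let G : ℝ × ℝ → ℝ := fun z => ∫ t in (0 : ℝ)..2 * Real.pi, t • F (rot t z)
  have hG : AnalyticAt ℝ G 0 :=
    analyticAt_intervalIntegral_comp_clm hF continuous_rot continuous_id _ _
  refine ⟨fun z => (2 * Real.pi)⁻¹ * G z, analyticAt_const.mul hG, ?_⟩
  filter_upwards [hG.eventually_analyticAt, eventually_forall_rot hF.eventually_analyticAt]
    with z hGz hFz
  have hcont : Continuous fun t => F (rot t z) := continuous_iff_continuousAt.2 fun t =>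
    (hFz t).continuousAt.comp (f := fun t => rot t z) (hasDerivAt_rot_apply t z).continuousAt
  have hper : Function.Periodic (fun t => F (rot t z)) (2 * Real.pi) := fun t =>
    congrArg (fun L : ℝ × ℝ →L[ℝ] ℝ × ℝ => F (L z)) (rot_periodic t)
  have hflow : HasDerivAt (fun τ => G (rot τ z))
      (2 * Real.pi * F z - ∫ t in (0 : ℝ)..2 * Real.pi, F (rot t z)) 0 := by
    simpa only [G, rot_rot, rot_zero, ContinuousLinearMap.id_apply, smul_eq_mul] using
      hasDerivAt_integral_id_smul_comp_add hcont hper 0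
  have hchain : HasDerivAt (fun τ => G (rot τ z)) (fderiv ℝ G z (quarterTurn z)) 0 := by
    simpa [Function.comp_def] using HasFDerivAt.comp_hasDerivAt (0 : ℝ)
      (by simpa using hGz.differentiableAt.hasFDerivAt) (hasDerivAt_rot_apply 0 z)
  rw [fderiv_const_mul hGz.differentiableAt, smul_apply, hchain.unique hflow, rotMean, smul_eq_mul]
  field_simp

end AngularAverage

section Twist

lemma det_radial_angular (R R' : ℝ) (ℓ : ℝ × ℝ →L[ℝ] ℝ) (z : ℝ × ℝ) :
    (R • ContinuousLinearMap.id ℝ (ℝ × ℝ) +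
      (R' • fderiv ℝ halfSq z).smulRight z + ℓ.smulRight (R • quarterTurn z)).det =
      (1 + ℓ (quarterTurn z)) * (R ^ 2 + halfSq z * (2 * R * R')) := by
  have hℓ : ℓ (quarterTurn z) = z.1 * ℓ (0, 1) - z.2 * ℓ (1, 0) := by
    rw [show quarterTurn z = z.1 • (0, 1) - z.2 • (1, 0) by simp [quarterTurn_apply], map_sub,
      map_smul, map_smul, smul_eq_mul, smul_eq_mul]
  rw [hℓ, det_clm_prod]
  simp only [quarterTurn_apply, halfSq, fderiv_halfSq_apply, add_apply, smul_apply, smul_eq_mul,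
    ContinuousLinearMap.id_apply, ContinuousLinearMap.smulRight_apply, Prod.fst_add, Prod.snd_add,
    Prod.smul_fst, Prod.smul_snd]
  ring

lemma hasFDerivAt_twist {g : ℝ × ℝ → ℝ} {ρ : ℝ → ℝ} {z : ℝ × ℝ} {ρ' : ℝ} {g' : ℝ × ℝ →L[ℝ] ℝ}
    (hg : HasFDerivAt g g' z) (hρ : HasDerivAt ρ ρ' (halfSq z)) :
    HasFDerivAt (fun z => ρ (halfSq z) • rot (g z) z)
      (rot (g z) ∘L (ρ (halfSq z) • ContinuousLinearMap.id ℝ (ℝ × ℝ) +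
        (ρ' • fderiv ℝ halfSq z).smulRight z + g'.smulRight (ρ (halfSq z) • quarterTurn z))) z := by
  have hR := hρ.comp_hasFDerivAt z (analyticAt_halfSq z).differentiableAt.hasFDerivAt
  have hrot := (hasDerivAt_rot (g z)).hasFDerivAt.comp z hg
  refine (hR.smul (hrot.clm_apply (hasFDerivAt_id z))).congr_fderiv
    (ContinuousLinearMap.ext fun v => ?_)
  simp only [Function.comp_apply, ContinuousLinearMap.comp_id, id_eq, add_apply, smul_apply,
    ContinuousLinearMap.flip_apply, ContinuousLinearMap.comp_apply, map_add, map_smul,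
    ContinuousLinearMap.toSpanSingleton_apply, quarterTurn_rot,
    ContinuousLinearMap.smulRight_apply, ContinuousLinearMap.id_apply]
  module

lemma det_fderiv_twist {g : ℝ × ℝ → ℝ} {ρ : ℝ → ℝ} {z : ℝ × ℝ} {ρ' : ℝ}
    (hg : DifferentiableAt ℝ g z) (hρ : HasDerivAt ρ ρ' (halfSq z)) :
    (fderiv ℝ (fun z => ρ (halfSq z) • rot (g z) z) z).det =
      (1 + fderiv ℝ g z (quarterTurn z)) *
        (ρ (halfSq z) ^ 2 + halfSq z * (2 * ρ (halfSq z) * ρ')) := by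
  rw [(hasFDerivAt_twist hg.hasFDerivAt hρ).fderiv, ← det_radial_angular]
  refine (LinearMap.det_comp _ _).trans ?_
  exact (congrArg (· * _) (det_rot (g z))).trans (one_mul _)

lemma analyticAt_twist {g : ℝ × ℝ → ℝ} {ρ : ℝ → ℝ} (hg : AnalyticAt ℝ g 0)
    (hρ : AnalyticAt ℝ ρ 0) : AnalyticAt ℝ (fun z => ρ (halfSq z) • rot (g z) z) 0 := by
  have hc : AnalyticAt ℝ (fun z => Real.cos (g z)) 0 := Real.analyticAt_cos.comp hg
  have hs : AnalyticAt ℝ (fun z => Real.sin (g z)) 0 := Real.analyticAt_sin.comp hg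
  simp only [rot_apply]
  exact (hρ.comp_of_eq (analyticAt_halfSq 0) halfSq_zero).smul
    (((hc.mul analyticAt_fst).sub (hs.mul analyticAt_snd)).prod
      ((hc.mul analyticAt_snd).add (hs.mul analyticAt_fst)))

/-- `I` is the action function of the circles `halfSq = s` for the area form `f dx ∧ dy`: some
analytic map fixing the origin takes `f dx ∧ dy` to `dx ∧ dy` and the circle of action `s` to that
of action `I s`. -/
structure IsActionFunction (f : ℝ × ℝ → ℝ) (I : ℝ → ℝ) : Prop where
  analyticAt : AnalyticAt ℝ I 0
  exists_chart : ∃ Z : ℝ × ℝ → ℝ × ℝ, AnalyticAt ℝ Z 0 ∧ Z 0 = 0 ∧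
    (∀ᶠ z in 𝓝 0, halfSq (Z z) = I (halfSq z)) ∧ ∀ᶠ z in 𝓝 0, (fderiv ℝ Z z).det = f z

/-- Coordinates are sought as a twist `z ↦ √J(|z|²/2) e^{i g(z)} z`: the radial factor absorbs the
circular means of `f`, and the angle `g` the oscillation of `f` along the circles. -/
lemma exists_isActionFunction {f : ℝ × ℝ → ℝ} {M : ℝ → ℝ} (hf : AnalyticAt ℝ f 0)
    (hM : AnalyticAt ℝ M 0) (hM0 : 0 < M 0)
    (hmean : ∀ᶠ z in 𝓝 0, rotMean f z = M (halfSq z)) :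
    ∃ I : ℝ → ℝ, IsActionFunction f I ∧ ∀ᶠ s in 𝓝 0, HasDerivAt I (M s) s := by
  have hMs : AnalyticAt ℝ (fun z => M (halfSq z)) 0 :=
    hM.comp_of_eq (analyticAt_halfSq 0) halfSq_zero
  obtain ⟨g, hg, hgD⟩ := exists_analyticAt_angular_primitive
    (hf.div hMs (by rw [halfSq_zero]; exact hM0.ne'))
  obtain ⟨J, hJ, hJ0, hJD⟩ := exists_analyticAt_average hM
  have hJpos : ∀ᶠ s in 𝓝 0, 0 < J s := hJ.continuousAt.eventually_const_lt (by rwa [hJ0])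
  have hMne : ∀ᶠ s in 𝓝 0, M s ≠ 0 := hM.continuousAt.eventually_ne hM0.ne'
  have hρ : AnalyticAt ℝ (fun s => √(J s)) 0 :=
    (analyticAt_sqrt (by rw [hJ0]; exact hM0.ne')).comp_of_eq hJ rfl
  refine ⟨fun s => s * J s, ⟨analyticAt_id.mul hJ, fun z => √(J (halfSq z)) • rot (g z) z,
    analyticAt_twist hg hρ, by simp, ?_, ?_⟩, hJD⟩
  · filter_upwards [tendsto_halfSq.eventually hJpos] with z hz
    rw [halfSq_smul, halfSq_rot, Real.sq_sqrt hz.le, mul_comm]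
  filter_upwards [hgD, hg.eventually_analyticAt, hmean, tendsto_halfSq.eventually
    (hJpos.and (hMne.and (hJD.and hJ.eventually_analyticAt)))]
    with z hgz hgan hmeanz ⟨hJz, hMz, hIz, hJan⟩
  have hJ' := hJan.differentiableAt.hasDerivAt
  have hangular : 1 + fderiv ℝ g z (quarterTurn z) = f z / M (halfSq z) := by
    have hdiv : rotMean (f / fun z => M (halfSq z)) z = rotMean f z / M (halfSq z) := by
      simp only [rotMean, Pi.div_apply, halfSq_rot, intervalIntegral.integral_div, mul_div_assoc]
    rw [hgz, hdiv, hmeanz, div_self hMz, Pi.div_apply]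
    ring
  have hradial : M (halfSq z) = J (halfSq z) + halfSq z * deriv J (halfSq z) := by
    simpa using hIz.unique ((hasDerivAt_id (halfSq z)).mul hJ')
  have hne : √(J (halfSq z)) ≠ 0 := (Real.sqrt_pos.2 hJz).ne'
  rw [det_fderiv_twist hgan.differentiableAt (hJ'.sqrt hJz.ne'), hangular, Real.sq_sqrt hJz.le,
    mul_div_cancel₀ _ (mul_ne_zero two_ne_zero hne), ← hradial, div_mul_cancel₀ _ hMz]

end Twist

section Rigidity

lemma eventually_nhdsGE_of_comp_halfSq {p : ℝ → Prop} (hp : ∀ᶠ z in 𝓝 0, p (halfSq z)) :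
    ∀ᶠ s in 𝓝[≥] 0, p s := by
  have hcont : Continuous (fun s : ℝ => (√(2 * s), (0 : ℝ))) := by fun_prop
  have htend : Tendsto (fun s : ℝ => (√(2 * s), (0 : ℝ))) (𝓝[≥] 0) (𝓝 0) :=
    tendsto_nhdsWithin_of_tendsto_nhds (hcont.tendsto' 0 0 (by simp))
  filter_upwards [htend.eventually hp, self_mem_nhdsWithin] with s hs hs0
  have hsq : halfSq (√(2 * s), 0) = s := by
    rw [halfSq, Real.sq_sqrt (mul_nonneg zero_le_two hs0)]
    ring
  rwa [hsq] at hs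

lemma eventuallyEq_of_comp_halfSq {u v : ℝ → ℝ} (hu : AnalyticAt ℝ u 0) (hv : AnalyticAt ℝ v 0)
    (h : ∀ᶠ z in 𝓝 0, u (halfSq z) = v (halfSq z)) : ∀ᶠ s in 𝓝 0, u s = v s :=
  (hu.frequently_eq_iff_eventually_eq hv).1
    (((eventually_nhdsGE_of_comp_halfSq h).filter_mono
      (nhdsWithin_mono 0 Set.Ioi_subset_Ici_self)).frequently.filter_mono
        (nhdsWithin_mono 0 fun _ hs => ne_of_gt hs))

/-- The identity `L J Lᵀ = J` for `det L = 1`, applied to `w` with `Lᵀ w = κ z`. -/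
lemma smul_apply_quarterTurn_of_det_eq_one {L : ℝ × ℝ →L[ℝ] ℝ × ℝ} (hL : L.det = 1) {κ : ℝ}
    {z w : ℝ × ℝ} (h : ∀ v, fderiv ℝ halfSq w (L v) = κ * fderiv ℝ halfSq z v) :
    κ • L (quarterTurn z) = quarterTurn w := by
  have h₁ := h (1, 0)
  have h₂ := h (0, 1)
  have hLz : L (quarterTurn z) = z.1 • L (0, 1) - z.2 • L (1, 0) := by
    rw [← map_smul, ← map_smul, ← map_sub]
    simp [quarterTurn_apply]
  rw [det_clm_prod] at hL
  simp only [fderiv_halfSq_apply, mul_one, mul_zero, add_zero, zero_add] at h₁ h₂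
  rw [hLz]
  ext <;> simp only [quarterTurn_apply, Prod.smul_fst, Prod.smul_snd, Prod.fst_sub, Prod.snd_sub,
    smul_eq_mul]
  · linear_combination (L (1, 0)).1 * h₂ - (L (0, 1)).1 * h₁ - w.2 * hL
  · linear_combination (L (1, 0)).2 * h₂ - (L (0, 1)).2 * h₁ + w.1 * hL

lemma eq_one_of_conformal {L : ℝ × ℝ →L[ℝ] ℝ × ℝ} (hL : L.det = 1) {κ : ℝ}
    (h : ∀ u v, fderiv ℝ halfSq (L u) (L v) = κ * fderiv ℝ halfSq u v) : κ = 1 := by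
  have h₁₁ := h (1, 0) (1, 0)
  have h₁₂ := h (1, 0) (0, 1)
  have h₂₂ := h (0, 1) (0, 1)
  rw [det_clm_prod] at hL
  simp only [fderiv_halfSq_apply, mul_one, mul_zero, add_zero, zero_add] at h₁₁ h₁₂ h₂₂
  have hκ : 0 ≤ κ := h₁₁ ▸ add_nonneg (mul_self_nonneg _) (mul_self_nonneg _)
  have hκ_sq : κ ^ 2 = 1 := by
    linear_combination (-κ) * h₁₁ - ((L (1, 0)).1 ^ 2 + (L (1, 0)).2 ^ 2) * h₂₂ +
      ((L (1, 0)).1 * (L (0, 1)).1 + (L (1, 0)).2 * (L (0, 1)).2) * h₁₂ +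
      ((L (1, 0)).1 * (L (0, 1)).2 - (L (0, 1)).1 * (L (1, 0)).2 + 1) * hL
  exact (pow_eq_one_iff_of_nonneg hκ two_ne_zero).1 hκ_sq

lemma cos_eq_one_of_rot_eq_self {t : ℝ} {w : ℝ × ℝ} (hw : halfSq w ≠ 0) (h : rot t w = w) :
    Real.cos t = 1 := by
  simp only [rot_apply, Prod.ext_iff] at h
  refine mul_right_cancel₀ hw ?_
  rw [halfSq]
  linear_combination (w.1 * h.1 + w.2 * h.2) / 2

variable {T : ℝ × ℝ → ℝ × ℝ} {χ : ℝ → ℝ}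

lemma eventually_fderiv_halfSq_map (hT : AnalyticAt ℝ T 0) (hχ : AnalyticAt ℝ χ 0)
    (h : ∀ᶠ z in 𝓝 0, halfSq (T z) = χ (halfSq z)) :
    ∀ᶠ z in 𝓝 0, ∀ v,
      fderiv ℝ halfSq (T z) (fderiv ℝ T z v) = deriv χ (halfSq z) * fderiv ℝ halfSq z v := by
  filter_upwards [hT.eventually_analyticAt, tendsto_halfSq.eventually hχ.eventually_analyticAt,
    h.eventually_nhds] with z hTz hχz hz v
  have hleft := (analyticAt_halfSq (T z)).differentiableAt.hasFDerivAt.comp z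
    hTz.differentiableAt.hasFDerivAt
  have hright := hχz.differentiableAt.hasDerivAt.comp_hasFDerivAt z
    (analyticAt_halfSq z).differentiableAt.hasFDerivAt
  exact congrArg (fun L : ℝ × ℝ →L[ℝ] ℝ => L v) (hleft.unique (hright.congr_of_eventuallyEq hz))

lemma fderiv_zero_conformal (hT : AnalyticAt ℝ T 0) (hT0 : T 0 = 0) (hχ : AnalyticAt ℝ χ 0)
    (h : ∀ᶠ z in 𝓝 0, halfSq (T z) = χ (halfSq z)) (u v : ℝ × ℝ) :
    fderiv ℝ halfSq (fderiv ℝ T 0 u) (fderiv ℝ T 0 v) = deriv χ 0 * fderiv ℝ halfSq u v := by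
  have hray : Tendsto (fun ε : ℝ => ε • u) (𝓝[≠] 0) (𝓝 0) :=
    tendsto_nhdsWithin_of_tendsto_nhds
      ((continuous_id.smul continuous_const).tendsto' 0 0 (zero_smul ℝ u))
  have hslope : Tendsto (fun ε : ℝ => ε⁻¹ • T (ε • u)) (𝓝[≠] 0) (𝓝 (fderiv ℝ T 0 u)) := by
    simpa [hT0] using (hT.differentiableAt.hasFDerivAt.hasLineDerivAt u).tendsto_slope_zero
  have hfderiv : Tendsto (fun ε : ℝ => fderiv ℝ T (ε • u) v) (𝓝[≠] 0) (𝓝 (fderiv ℝ T 0 v)) :=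
    ((ContinuousLinearMap.apply ℝ (ℝ × ℝ) v).continuous.tendsto _).comp
      (hT.fderiv.continuousAt.tendsto.comp hray)
  have hderiv : Tendsto (fun ε : ℝ => deriv χ (halfSq (ε • u))) (𝓝[≠] 0) (𝓝 (deriv χ 0)) :=
    hχ.deriv.continuousAt.tendsto.comp (tendsto_halfSq.comp hray)
  have hlim : Tendsto
      (fun ε : ℝ => fderiv ℝ halfSq (ε⁻¹ • T (ε • u)) (fderiv ℝ T (ε • u) v)) (𝓝[≠] 0)
      (𝓝 (fderiv ℝ halfSq (fderiv ℝ T 0 u) (fderiv ℝ T 0 v))) :=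
    (isBoundedBilinearMap_apply.continuous.tendsto (_, _)).comp
      (((analyticAt_halfSq _).fderiv.continuousAt.tendsto.comp hslope).prodMk_nhds hfderiv)
  refine tendsto_nhds_unique hlim ((hderiv.mul_const _).congr' ?_)
  filter_upwards [hray.eventually (eventually_fderiv_halfSq_map hT hχ h), self_mem_nhdsWithin]
    with ε hε hε0
  have hinv : ε⁻¹ * ε = 1 := inv_mul_cancel₀ hε0
  have hεv := hε v
  simp only [fderiv_halfSq_apply, Prod.smul_fst, Prod.smul_snd, smul_eq_mul] at hεv ⊢
  linear_combination (-ε⁻¹) * hεv - deriv χ (halfSq (ε • u)) * (u.1 * v.1 + u.2 * v.2) * hinv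

lemma eventually_map_rot (hT : AnalyticAt ℝ T 0) (hdet : ∀ᶠ z in 𝓝 0, (fderiv ℝ T z).det = 1)
    (hχ : AnalyticAt ℝ χ 0) (h : ∀ᶠ z in 𝓝 0, halfSq (T z) = χ (halfSq z)) :
    ∀ᶠ z in 𝓝 0, deriv χ (halfSq z) ≠ 0 →
      ∀ t, T (rot t z) = rot ((deriv χ (halfSq z))⁻¹ * t) (T z) := by
  filter_upwards [eventually_forall_rot (hT.eventually_analyticAt.and
    (hdet.and (eventually_fderiv_halfSq_map hT hχ h)))] with z hz hκ t
  have hflow : ∀ t, HasDerivAt (fun t => T (rot t z))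
      ((deriv χ (halfSq z))⁻¹ • quarterTurn (T (rot t z))) t := by
    intro t
    obtain ⟨hTt, hdett, hradial⟩ := hz t
    rw [← smul_apply_quarterTurn_of_det_eq_one hdett hradial, halfSq_rot, inv_smul_smul₀ hκ]
    exact hTt.differentiableAt.hasFDerivAt.comp_hasDerivAt t (hasDerivAt_rot_apply t z)
  simpa using eq_rot_of_hasDerivAt hflow t

lemma deriv_zero_eq_one_of_det_eq_one (hT : AnalyticAt ℝ T 0) (hT0 : T 0 = 0)
    (hdet : (fderiv ℝ T 0).det = 1) (hχ : AnalyticAt ℝ χ 0)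
    (h : ∀ᶠ z in 𝓝 0, halfSq (T z) = χ (halfSq z)) : deriv χ 0 = 1 :=
  eq_one_of_conformal hdet (fderiv_zero_conformal hT hT0 hχ h)

lemma eq_one_of_cos_two_pi_mul_inv {x : ℝ} (h : Real.cos (x⁻¹ * (2 * Real.pi)) = 1)
    (hx_half : 1 / 2 < x) : x = 1 := by
  obtain ⟨n, hn⟩ := (Real.cos_eq_one_iff _).1 h
  have hinv : (n : ℝ) = x⁻¹ := mul_right_cancel₀ Real.two_pi_pos.ne' hn
  have hx : 0 < x := by linarith
  have hn_pos : (0 : ℝ) < n := hinv ▸ inv_pos.2 hx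
  have hn_lt : (n : ℝ) < 2 := by
    rw [hinv]
    exact inv_lt_of_inv_lt₀ zero_lt_two (by linarith)
  have hn_one : n = 1 := by
    have : 0 < n := by exact_mod_cast hn_pos
    have : n < 2 := by exact_mod_cast hn_lt
    omega
  rw [hn_one, Int.cast_one] at hinv
  exact inv_eq_one.1 hinv.symm

/-- The map `T` carries the circle of action `s` to a circle and turns it by the angle
`t ↦ t / χ'(s)`; as the image of the full turn closes up, `1 / χ'(s)` is an integer, and it is
close to `1`. -/
lemma eventually_deriv_eq_one_of_det_eq_one (hT : AnalyticAt ℝ T 0) (hT0 : T 0 = 0)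
    (hdet : ∀ᶠ z in 𝓝 0, (fderiv ℝ T z).det = 1) (hχ : AnalyticAt ℝ χ 0)
    (h : ∀ᶠ z in 𝓝 0, halfSq (T z) = χ (halfSq z)) : ∀ᶠ s in 𝓝 0, deriv χ s = 1 := by
  have hone : deriv χ 0 = 1 :=
    deriv_zero_eq_one_of_det_eq_one hT hT0 hdet.self_of_nhds hχ h
  have hnear : ∀ᶠ s in 𝓝 0, 1 / 2 < deriv χ s :=
    hχ.deriv.continuousAt.eventually_const_lt (by norm_num [hone])
  have hne : ∀ᶠ s in 𝓝 0, s ≠ 0 → χ s ≠ 0 := by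
    have := hχ.differentiableAt.hasDerivAt.eventually_ne (c := 0) (hone ▸ one_ne_zero)
    simpa only [eventually_nhdsWithin_iff, Set.mem_compl_singleton_iff] using this
  have hcircle : ∀ᶠ z in 𝓝 0, halfSq z ≠ 0 → deriv χ (halfSq z) = 1 := by
    filter_upwards [h, eventually_map_rot hT hdet hχ h, tendsto_halfSq.eventually hnear,
      tendsto_halfSq.eventually hne] with z hz hrot hderiv hχz hz0
    have hpos : 0 < deriv χ (halfSq z) := one_half_pos.trans hderiv
    have hclosed := hrot hpos.ne' (2 * Real.pi)
    rw [rot_periodic.eq, rot_zero, ContinuousLinearMap.id_apply] at hclosed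
    exact eq_one_of_cos_two_pi_mul_inv (cos_eq_one_of_rot_eq_self (hz ▸ hχz hz0) hclosed.symm)
      hderiv
  refine eventuallyEq_of_comp_halfSq hχ.deriv analyticAt_const ?_
  filter_upwards [hcircle] with z hz
  rcases eq_or_ne (halfSq z) 0 with hz0 | hz0
  exacts [hz0 ▸ hone, hz hz0]

lemma eventually_eq_self_of_det_eq_one (hT : AnalyticAt ℝ T 0) (hT0 : T 0 = 0)
    (hdet : ∀ᶠ z in 𝓝 0, (fderiv ℝ T z).det = 1) (hχ : AnalyticAt ℝ χ 0)
    (h : ∀ᶠ z in 𝓝 0, halfSq (T z) = χ (halfSq z)) : ∀ᶠ s in 𝓝 0, χ s = s := by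
  have hχ0 : χ 0 = 0 := by simpa [hT0] using h.self_of_nhds.symm
  obtain ⟨ε, hε, hball⟩ := Metric.eventually_nhds_iff_ball.1
    (hχ.eventually_analyticAt.and (eventually_deriv_eq_one_of_det_eq_one hT hT0 hdet hχ h))
  refine Metric.eventually_nhds_iff_ball.2 ⟨ε, hε, ?_⟩
  refine Metric.isOpen_ball.eqOn_of_deriv_eq (convex_ball 0 ε).isPreconnected
    (fun s hs => (hball s hs).1.differentiableAt.differentiableWithinAt)
    differentiableOn_id (fun s hs => ?_) (Metric.mem_ball_self hε) hχ0
  exact (hball s hs).2.trans (deriv_id s).symm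

end Rigidity

section PlanarNormalForm

/-- `Q` is the inverse of an analytic Darboux chart of the plane centred at the origin, for the
area form `f dx ∧ dy`. -/
structure IsPlanarDarbouxChart (f : ℝ × ℝ → ℝ) (Q : ℝ × ℝ → ℝ × ℝ) : Prop where
  analyticAt : AnalyticAt ℝ Q 0
  map_zero : Q 0 = 0
  pullback_form : ∀ᶠ z in 𝓝 0, f (Q z) * (fderiv ℝ Q z).det = 1

/-- `χ` is a Birkhoff normal form of `halfSq` for the area form `f dx ∧ dy`: in a suitable Darboux
chart centred at the origin, `halfSq` becomes `χ ∘ halfSq`. -/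
structure IsPlanarNormalForm (f : ℝ × ℝ → ℝ) (χ : ℝ → ℝ) : Prop where
  analyticAt : AnalyticAt ℝ χ 0
  exists_chart : ∃ Q : ℝ × ℝ → ℝ × ℝ, IsPlanarDarbouxChart f Q ∧
    ∀ᶠ z in 𝓝 0, halfSq (Q z) = χ (halfSq z)

variable {f : ℝ × ℝ → ℝ} {Q : ℝ × ℝ → ℝ × ℝ} {I χ : ℝ → ℝ}

lemma IsPlanarDarbouxChart.tendsto (hQ : IsPlanarDarbouxChart f Q) : Tendsto Q (𝓝 0) (𝓝 0) := by
  simpa only [hQ.map_zero] using hQ.analyticAt.continuousAt.tendsto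

lemma IsActionFunction.map_zero (hI : IsActionFunction f I) : I 0 = 0 := by
  obtain ⟨Z, -, hZ0, hZI, -⟩ := hI.exists_chart
  simpa [hZ0] using hZI.self_of_nhds.symm

lemma IsPlanarNormalForm.map_zero (hχ : IsPlanarNormalForm f χ) : χ 0 = 0 := by
  obtain ⟨Q, hQ, hQχ⟩ := hχ.exists_chart
  simpa [hQ.map_zero] using hQχ.self_of_nhds.symm

lemma det_fderiv_comp {S T : ℝ × ℝ → ℝ × ℝ} {z : ℝ × ℝ} (hS : DifferentiableAt ℝ S (T z))
    (hT : DifferentiableAt ℝ T z) :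
    (fderiv ℝ (S ∘ T) z).det = (fderiv ℝ S (T z)).det * (fderiv ℝ T z).det := by
  rw [fderiv_comp z hS hT]
  exact LinearMap.det_comp _ _

lemma IsActionFunction.isPlanarNormalForm (hI : IsActionFunction f I) (hf0 : f 0 ≠ 0)
    (hχ : AnalyticAt ℝ χ 0) (hχI : ∀ᶠ s in 𝓝 0, χ (I s) = s) : IsPlanarNormalForm f χ := by
  obtain ⟨Z, hZ, hZ0, hZI, hZdet⟩ := hI.exists_chart
  obtain ⟨Q, hQ, hQZ, hZQ, -⟩ :=
    exists_analyticAt_localInverse_of_det_ne_zero hZ (hZdet.self_of_nhds ▸ hf0)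
  rw [hZ0] at hQ hQZ hZQ
  have hQtend : Tendsto Q (𝓝 0) (𝓝 0) := by
    simpa only [hQZ] using hQ.continuousAt.tendsto
  refine ⟨hχ, Q, ⟨hQ, hQZ, ?_⟩, ?_⟩
  · filter_upwards [hQtend.eventually (hZdet.and hZ.eventually_analyticAt),
      hQ.eventually_analyticAt, eventually_eventuallyEq_nhds.2 hZQ] with w ⟨hdet, hZw⟩ hQw hw
    have hid : Z ∘ Q =ᶠ[𝓝 w] id := hw
    have hdet_id : (fderiv ℝ (Z ∘ Q) w).det = 1 := by
      rw [hid.fderiv_eq, fderiv_id]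
      exact LinearMap.det_id
    rw [← hdet, ← det_fderiv_comp hZw.differentiableAt hQw.differentiableAt, hdet_id]
  · filter_upwards [hZQ, hQtend.eventually hZI, (tendsto_halfSq.comp hQtend).eventually hχI]
      with w hw hact hinv
    calc halfSq (Q w) = χ (I (halfSq (Q w))) := hinv.symm
      _ = χ (halfSq w) := by rw [← hact, hw]

lemma IsPlanarNormalForm.eventually_action_apply (hχ : IsPlanarNormalForm f χ)
    (hI : IsActionFunction f I) : ∀ᶠ t in 𝓝 0, I (χ t) = t := by
  have hχ0 := hχ.map_zero
  obtain ⟨Z, hZ, hZ0, hZI, hZdet⟩ := hI.exists_chart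
  obtain ⟨Q, hQ, hQχ⟩ := hχ.exists_chart
  refine eventually_eq_self_of_det_eq_one (hZ.comp_of_eq hQ.analyticAt hQ.map_zero)
    (by simp [hQ.map_zero, hZ0]) ?_
    (hI.analyticAt.comp_of_eq hχ.analyticAt hχ0) ?_
  · filter_upwards [hQ.tendsto.eventually (hZdet.and hZ.eventually_analyticAt), hQ.pullback_form,
      hQ.analyticAt.eventually_analyticAt] with z ⟨hdet, hZz⟩ hz hQz
    rw [det_fderiv_comp hZz.differentiableAt hQz.differentiableAt, hdet, hz]
  · filter_upwards [hQ.tendsto.eventually hZI, hQχ] with z hz hz'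
    exact hz.trans (congrArg I hz')

end PlanarNormalForm

section EllipticIntegral

lemma image_sin_Ioo_zero_pi_div_two : Real.sin '' Set.Ioo 0 (Real.pi / 2) = Set.Ioo 0 1 := by
  refine Set.Subset.antisymm ?_ fun x hx =>
    ⟨Real.arcsin x, ⟨Real.arcsin_pos.2 hx.1, Real.arcsin_lt_pi_div_two.2 hx.2⟩,
      Real.sin_arcsin (by linarith [hx.1]) hx.2.le⟩
  rintro _ ⟨t, ht, rfl⟩
  refine ⟨Real.sin_pos_of_pos_of_lt_pi ht.1 (by linarith [ht.2, Real.pi_pos]), ?_⟩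
  rw [← Real.sin_pi_div_two]
  exact Real.sin_lt_sin_of_lt_of_le_pi_div_two (by linarith [ht.1, Real.pi_pos]) le_rfl ht.2

lemma integral_one_div_sqrt_one_sub_mul_sin_sq (lam : ℝ) :
    ∫ t in (0 : ℝ)..Real.pi / 2, 1 / √(1 - lam * Real.sin t ^ 2) = ellipticK lam := by
  have hinj : Set.InjOn Real.sin (Set.Ioo 0 (Real.pi / 2)) :=
    Real.injOn_sin.mono (Set.Ioo_subset_Icc_self.trans
      (Set.Icc_subset_Icc_left (by linarith [Real.pi_pos])))
  rw [ellipticK, intervalIntegral.integral_of_le (by positivity),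
    intervalIntegral.integral_of_le zero_le_one, MeasureTheory.integral_Ioc_eq_integral_Ioo,
    MeasureTheory.integral_Ioc_eq_integral_Ioo, ← image_sin_Ioo_zero_pi_div_two,
    MeasureTheory.integral_image_eq_integral_abs_deriv_smul measurableSet_Ioo
      (fun t _ => (Real.hasDerivAt_sin t).hasDerivWithinAt) hinj]
  refine MeasureTheory.setIntegral_congr_fun measurableSet_Ioo fun t ht => ?_
  have hcos : 0 < Real.cos t := Real.cos_pos_of_mem_Ioo ⟨by linarith [ht.1, ht.2], ht.2⟩
  simp only [smul_eq_mul]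
  rw [← Real.cos_sq', Real.sqrt_mul (sq_nonneg _), Real.sqrt_sq hcos.le, abs_of_pos hcos]
  field_simp

lemma integral_comp_cos_sq {E : Type*} [NormedAddCommGroup E] [NormedSpace ℝ E] {F : ℝ → E}
    (hF : Continuous fun t => F (Real.cos t ^ 2)) :
    ∫ t in (0 : ℝ)..2 * Real.pi, F (Real.cos t ^ 2) =
      (4 : ℝ) • ∫ t in (0 : ℝ)..Real.pi / 2, F (Real.sin t ^ 2) := by
  have hint : ∀ a b, IntervalIntegrable (fun t => F (Real.cos t ^ 2)) MeasureTheory.volume a b :=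
    fun a b => hF.intervalIntegrable a b
  have hfirst : ∫ t in (0 : ℝ)..Real.pi / 2, F (Real.cos t ^ 2) =
      ∫ t in (0 : ℝ)..Real.pi / 2, F (Real.sin t ^ 2) := by
    have := intervalIntegral.integral_comp_sub_left (a := 0) (b := Real.pi / 2)
      (fun t => F (Real.cos t ^ 2)) (Real.pi / 2)
    simpa [Real.cos_pi_div_two_sub] using this.symm
  have hsecond : ∫ t in (Real.pi / 2)..Real.pi, F (Real.cos t ^ 2) =
      ∫ t in (0 : ℝ)..Real.pi / 2, F (Real.sin t ^ 2) := by
    have := intervalIntegral.integral_comp_add_right (a := 0) (b := Real.pi / 2)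
      (fun t => F (Real.cos t ^ 2)) (Real.pi / 2)
    simpa [Real.cos_add_pi_div_two] using this.symm
  have hlower : ∫ t in Real.pi..2 * Real.pi, F (Real.cos t ^ 2) =
      ∫ t in (0 : ℝ)..Real.pi, F (Real.cos t ^ 2) := by
    have := intervalIntegral.integral_comp_add_right (a := 0) (b := Real.pi)
      (fun t => F (Real.cos t ^ 2)) Real.pi
    simpa [Real.cos_add_pi, two_mul] using this.symm
  rw [← intervalIntegral.integral_add_adjacent_intervals (hint 0 Real.pi) (hint _ _), hlower,
    ← intervalIntegral.integral_add_adjacent_intervals (hint 0 (Real.pi / 2)) (hint _ _), hfirst,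
    hsecond]
  module

lemma integral_one_div_sqrt_one_sub_mul_cos_sq {lam : ℝ} (hlam : lam < 1) :
    ∫ t in (0 : ℝ)..2 * Real.pi, 1 / √(1 - lam * Real.cos t ^ 2) = 4 * ellipticK lam := by
  have hpos : ∀ t, 0 < 1 - lam * Real.cos t ^ 2 := by
    intro t
    rcases le_or_gt lam 0 with h | h
    · linarith [mul_nonpos_of_nonpos_of_nonneg h (sq_nonneg (Real.cos t))]
    · linarith [mul_le_of_le_one_right h.le (Real.cos_sq_le_one t)]
  rw [integral_comp_cos_sq (F := fun x => 1 / √(1 - lam * x))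
    (continuous_const.div (by fun_prop) fun t => (Real.sqrt_pos.2 (hpos t)).ne'),
    integral_one_div_sqrt_one_sub_mul_sin_sq, smul_eq_mul]

end EllipticIntegral

section MeanDensity

/-- Half the squared norm of `(p₂, p₃)` in terms of the rescaled coordinates
`(√A p₂, √B p₃)`. -/
noncomputable def transverseHalfSq (A B : ℝ) (z : ℝ × ℝ) : ℝ := (z.1 ^ 2 / A + z.2 ^ 2 / B) / 2

/-- The density of the symplectic form with respect to the rescaled coordinates
`(√A p₂, √B p₃)` on the hemisphere `0 < p₁`, at the points where `(p₂² + p₃²) / 2 = w`. -/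
noncomputable def density (A B l w : ℝ) : ℝ := 1 / (3 * √(A * B) * √(2 * l - 2 * w))

/-- The mean of the symplectic density over the circle `halfSq = s` in the rescaled coordinates. -/
noncomputable def meanDensity (A B l s : ℝ) : ℝ :=
  (2 * Real.pi)⁻¹ * ∫ t in (0 : ℝ)..2 * Real.pi,
    density A B l ((Real.cos t ^ 2 / A + Real.sin t ^ 2 / B) * s)

@[simp]
lemma transverseHalfSq_zero (A B : ℝ) : transverseHalfSq A B 0 = 0 := by simp [transverseHalfSq]

lemma analyticAt_transverseHalfSq (A B : ℝ) (z : ℝ × ℝ) :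
    AnalyticAt ℝ (transverseHalfSq A B) z := by
  unfold transverseHalfSq
  exact ((analyticAt_fst.pow 2).div_const.add (analyticAt_snd.pow 2).div_const).div_const

variable {A B l : ℝ}

lemma density_zero_pos (hA : 0 < A) (hB : 0 < B) (hl : 0 < l) : 0 < density A B l 0 := by
  rw [density, mul_zero, sub_zero]
  positivity

lemma analyticAt_density (hA : 0 < A) (hB : 0 < B) (hl : 0 < l) :
    AnalyticAt ℝ (density A B l) 0 := by
  have hl' : 0 < 2 * l - 2 * 0 := by linarith
  have harg : AnalyticAt ℝ (fun w : ℝ => 2 * l - 2 * w) 0 := by fun_prop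
  have hsqrt : AnalyticAt ℝ (fun w : ℝ => √(2 * l - 2 * w)) 0 :=
    (analyticAt_sqrt hl'.ne').comp_of_eq harg rfl
  exact analyticAt_const.div (analyticAt_const.mul hsqrt) (by positivity)

lemma analyticAt_density_comp_transverseHalfSq (hA : 0 < A) (hB : 0 < B) (hl : 0 < l) :
    AnalyticAt ℝ (density A B l ∘ transverseHalfSq A B) 0 :=
  (analyticAt_density hA hB hl).comp_of_eq (analyticAt_transverseHalfSq A B 0)
    (transverseHalfSq_zero A B)

lemma analyticAt_meanDensity (hA : 0 < A) (hB : 0 < B) (hl : 0 < l) :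
    AnalyticAt ℝ (meanDensity A B l) 0 := by
  have hmean := analyticAt_intervalIntegral_comp_clm (analyticAt_density hA hB hl)
    (L := fun t => (Real.cos t ^ 2 / A + Real.sin t ^ 2 / B) • ContinuousLinearMap.id ℝ ℝ)
    (by fun_prop) (w := fun _ => 1) continuous_const 0 (2 * Real.pi)
  unfold meanDensity
  simpa using analyticAt_const.fun_mul hmean

lemma meanDensity_zero (A B l : ℝ) : meanDensity A B l 0 = density A B l 0 := by
  simp only [meanDensity, mul_zero, intervalIntegral.integral_const, sub_zero, smul_eq_mul]
  exact inv_mul_cancel_left₀ Real.two_pi_pos.ne' _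

lemma rotMean_density (A B l : ℝ) (z : ℝ × ℝ) :
    rotMean (density A B l ∘ transverseHalfSq A B) z = meanDensity A B l (halfSq z) := by
  obtain ⟨θ, hθ⟩ := exists_eq_rot z
  have hz : 0 ≤ 2 * halfSq z := by
    rw [halfSq]
    positivity
  have hcircle : ∀ t, transverseHalfSq A B (rot t (√(2 * halfSq z), 0)) =
      (Real.cos t ^ 2 / A + Real.sin t ^ 2 / B) * halfSq z := by
    intro t
    simp only [transverseHalfSq, rot_apply, mul_zero, sub_zero, zero_add, mul_pow, Real.sq_sqrt hz]
    ring
  conv_lhs => rw [hθ, rotMean_rot]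
  simp only [rotMean, meanDensity, Function.comp_apply, hcircle]

variable {a b c d : ℝ}

lemma one_sub_modulus (hab : a ≠ b) (hdc : d ≠ c) :
    1 - (d - a) * (b - c) / ((d - c) * (b - a)) =
      (d - b) * (a - c) / ((a - b) * (d - c)) := by
  have h₁ : a - b ≠ 0 := sub_ne_zero.2 hab
  have h₂ : d - c ≠ 0 := sub_ne_zero.2 hdc
  have h₃ : b - a ≠ 0 := sub_ne_zero.2 hab.symm
  field_simp
  ring

lemma density_eq_inv_sqrt_modulus (hl : 0 < l) (hba : b < a) (hca : c < a) (hcd : c < d) (t : ℝ) :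
    density (a - b) (a - c) l
        ((Real.cos t ^ 2 / (a - b) + Real.sin t ^ 2 / (a - c)) * (l * (a - d))) =
      1 / (3 * √(2 * l) * √((d - c) * (a - b))) *
        (1 / √(1 - (d - a) * (b - c) / ((d - c) * (b - a)) * Real.cos t ^ 2)) := by
  have hab : 0 < a - b := sub_pos.2 hba
  have hac : 0 < a - c := sub_pos.2 hca
  have hdc : 0 < d - c := sub_pos.2 hcd
  have hba' : b - a ≠ 0 := (sub_neg.2 hba).ne
  have hradicand : (a - b) * (a - c) * (2 * l - 2 * ((Real.cos t ^ 2 / (a - b) +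
      Real.sin t ^ 2 / (a - c)) * (l * (a - d)))) = 2 * l * (((d - c) * (a - b)) *
        (1 - (d - a) * (b - c) / ((d - c) * (b - a)) * Real.cos t ^ 2)) := by
    rw [Real.sin_sq]
    field_simp
    ring
  rw [density, mul_assoc, ← Real.sqrt_mul (by positivity), hradicand,
    Real.sqrt_mul (by positivity : 0 ≤ 2 * l), Real.sqrt_mul (mul_pos hdc hab).le]
  ring

lemma meanDensity_eq_neg_periodS (hl : 0 < l) (hba : b < a) (hca : c < a) (hbd : b < d)
    (hcd : c < d) : meanDensity (a - b) (a - c) l (l * (a - d)) = -periodS l a b c d := by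
  have hmodulus : (d - a) * (b - c) / ((d - c) * (b - a)) < 1 := by
    rw [← sub_pos, one_sub_modulus hba.ne' hcd.ne']
    exact div_pos (mul_pos (sub_pos.2 hbd) (sub_pos.2 hca))
      (mul_pos (sub_pos.2 hba) (sub_pos.2 hcd))
  have hsqrt : √(2 / l) = 2 / √(2 * l) := by
    rw [eq_div_iff (by positivity), ← Real.sqrt_mul (by positivity),
      show 2 / l * (2 * l) = 2 ^ 2 by field_simp, Real.sqrt_sq zero_le_two]
  simp only [meanDensity, density_eq_inv_sqrt_modulus hl hba hca hcd]
  rw [intervalIntegral.integral_const_mul, integral_one_div_sqrt_one_sub_mul_cos_sq hmodulus,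
    periodS, hsqrt]
  ring

end MeanDensity

section Sphere

/-- The energy of the free rigid body in terms of the reciprocals `a`, `b`, `c` of its moments of
inertia. -/
noncomputable def diagonalHamiltonian (a b c : ℝ) (P : Fin 3 → ℝ) : ℝ :=
  (a * P 0 ^ 2 + b * P 1 ^ 2 + c * P 2 ^ 2) / 2

/-- The rescaled coordinates `(√A p₂, √B p₃)`. For `A = a - b` and `B = a - c`, the function
`halfSq` of these coordinates is `l a - H` on the sphere. -/
noncomputable def scaledProj (A B : ℝ) : (Fin 3 → ℝ) →L[ℝ] ℝ × ℝ :=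
  (√A • ContinuousLinearMap.proj 1).prod (√B • ContinuousLinearMap.proj 2)

/-- The point of the hemisphere `0 < p₁` of the sphere `casimir = l` with given rescaled
coordinates. -/
noncomputable def scaledLift (A B l : ℝ) (z : ℝ × ℝ) : Fin 3 → ℝ :=
  ![√(2 * l - 2 * transverseHalfSq A B z), z.1 / √A, z.2 / √B]

lemma energy_eq_diagonalHamiltonian (I₁ I₂ I₃ : ℝ) :
    energy I₁ I₂ I₃ = diagonalHamiltonian (1 / I₁) (1 / I₂) (1 / I₃) := by
  funext P
  rw [energy, diagonalHamiltonian]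
  ring

lemma diagonalHamiltonian_neg (a b c : ℝ) (P : Fin 3 → ℝ) :
    diagonalHamiltonian a b c (-P) = diagonalHamiltonian a b c P := by
  simp [diagonalHamiltonian]

lemma casimir_neg (P : Fin 3 → ℝ) : casimir (-P) = casimir P := by simp [casimir]

lemma orbitForm_neg (P u v : Fin 3 → ℝ) : orbitForm (-P) (-u) (-v) = orbitForm P v u := by
  simp only [orbitForm, ← cross_anticomm u v, map_neg, LinearMap.neg_apply, neg_neg,
    neg_dotProduct, dotProduct_neg]

lemma scaledProj_apply (A B : ℝ) (P : Fin 3 → ℝ) : scaledProj A B P = (√A * P 1, √B * P 2) := rfl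

variable {A B l a b c : ℝ} {P : Fin 3 → ℝ}

lemma diagonalHamiltonian_eq_sub_halfSq (hba : b ≤ a) (hca : c ≤ a) (hP : casimir P = l) :
    diagonalHamiltonian a b c P = l * a - halfSq (scaledProj (a - b) (a - c) P) := by
  rw [← hP, halfSq, scaledProj_apply, mul_pow, mul_pow, Real.sq_sqrt (sub_nonneg.2 hba),
    Real.sq_sqrt (sub_nonneg.2 hca), diagonalHamiltonian, casimir]
  ring

lemma density_transverseHalfSq_scaledProj (hA : 0 < A) (hB : 0 < B) (hP : casimir P = l)
    (hP0 : 0 < P 0) :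
    density A B l (transverseHalfSq A B (scaledProj A B P)) = 1 / (3 * √(A * B) * P 0) := by
  have htrans : transverseHalfSq A B (scaledProj A B P) = (P 1 ^ 2 + P 2 ^ 2) / 2 := by
    rw [transverseHalfSq, scaledProj_apply, mul_pow, mul_pow, Real.sq_sqrt hA.le,
      Real.sq_sqrt hB.le, mul_div_cancel_left₀ _ hA.ne', mul_div_cancel_left₀ _ hB.ne']
  have hsq : 2 * l - 2 * transverseHalfSq A B (scaledProj A B P) = P 0 ^ 2 := by
    rw [htrans, ← hP, casimir]
    ring
  rw [density, hsq, Real.sqrt_sq hP0.le]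

lemma scaledProj_scaledLift (hA : 0 < A) (hB : 0 < B) (l : ℝ) (z : ℝ × ℝ) :
    scaledProj A B (scaledLift A B l z) = z :=
  Prod.ext (mul_div_cancel₀ z.1 (Real.sqrt_ne_zero'.2 hA))
    (mul_div_cancel₀ z.2 (Real.sqrt_ne_zero'.2 hB))

lemma casimir_scaledLift (hA : 0 ≤ A) (hB : 0 ≤ B) {z : ℝ × ℝ}
    (hz : 0 ≤ 2 * l - 2 * transverseHalfSq A B z) : casimir (scaledLift A B l z) = l := by
  change (√(2 * l - 2 * transverseHalfSq A B z) ^ 2 + (z.1 / √A) ^ 2 + (z.2 / √B) ^ 2) / 2 = l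
  rw [div_pow, div_pow, Real.sq_sqrt hz, Real.sq_sqrt hA, Real.sq_sqrt hB, transverseHalfSq]
  ring

lemma scaledLift_zero (A B l : ℝ) : scaledLift A B l 0 = ![√(2 * l), 0, 0] := by
  simp [scaledLift]

lemma analyticAt_scaledLift (A B : ℝ) (hl : 0 < l) : AnalyticAt ℝ (scaledLift A B l) 0 := by
  have harg : AnalyticAt ℝ (fun z => 2 * l - 2 * transverseHalfSq A B z) 0 :=
    analyticAt_const.sub (analyticAt_const.mul (analyticAt_transverseHalfSq A B 0))
  have hne : 2 * l - 2 * transverseHalfSq A B 0 ≠ 0 := by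
    rw [transverseHalfSq_zero]
    linarith
  refine AnalyticAt.pi fun i => ?_
  fin_cases i
  · exact (analyticAt_sqrt hne).comp_of_eq harg rfl
  · exact analyticAt_fst.div_const
  · exact analyticAt_snd.div_const

lemma hasFDerivAt_casimir (P : Fin 3 → ℝ) :
    HasFDerivAt casimir (∑ i, P i • ContinuousLinearMap.proj (R := ℝ) (φ := fun _ => ℝ) i) P := by
  have hcoord (i : Fin 3) := ((hasFDerivAt_apply (𝕜 := ℝ) i P).pow 2).mul_const (1 / 2 : ℝ)
  have hsum := HasFDerivAt.fun_sum (u := Finset.univ) fun i _ => hcoord i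
  refine (hsum.congr_fderiv ?_).congr_of_eventuallyEq (.of_forall fun Q => ?_)
  · congr! 1 with i
    rw [pow_one, smul_smul, nsmul_eq_mul]
    congr 1
    ring
  · simp only [casimir, Fin.sum_univ_three]
    ring

lemma dotProduct_fderiv_eq_zero {E : Type*} [NormedAddCommGroup E] [NormedSpace ℝ E]
    {ψ : E → Fin 3 → ℝ} {x : E} (hψ : DifferentiableAt ℝ ψ x)
    (hcas : ∀ᶠ y in 𝓝 x, casimir (ψ y) = l) (v : E) : ψ x ⬝ᵥ fderiv ℝ ψ x v = 0 := by
  have hconst : HasFDerivAt (casimir ∘ ψ) (0 : E →L[ℝ] ℝ) x :=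
    (hasFDerivAt_const l x).congr_of_eventuallyEq hcas
  have hzero := congrArg (· v) (((hasFDerivAt_casimir (ψ x)).comp x hψ.hasFDerivAt).unique hconst)
  simpa [dotProduct] using hzero

lemma orbitForm_fderiv_eq (hA : 0 < A) (hB : 0 < B) {ψ : ℝ × ℝ → Fin 3 → ℝ} {z : ℝ × ℝ}
    (hψ : DifferentiableAt ℝ ψ z) (hcas : ∀ᶠ w in 𝓝 z, casimir (ψ w) = l) (hpos : 0 < ψ z 0) :
    orbitForm (ψ z) (fderiv ℝ ψ z (1, 0)) (fderiv ℝ ψ z (0, 1)) =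
      density A B l (transverseHalfSq A B (scaledProj A B (ψ z))) *
        (fderiv ℝ (scaledProj A B ∘ ψ) z).det := by
  have htangent := dotProduct_fderiv_eq_zero hψ hcas
  have hA' : √A ≠ 0 := Real.sqrt_ne_zero'.2 hA
  have hB' : √B ≠ 0 := Real.sqrt_ne_zero'.2 hB
  rw [orbitForm_eq₁ _ _ _ (htangent _) (htangent _) hpos.ne',
    density_transverseHalfSq_scaledProj hA hB hcas.self_of_nhds hpos,
    ((scaledProj A B).hasFDerivAt.comp z hψ.hasFDerivAt).fderiv, det_clm_prod,
    Real.sqrt_mul hA.le]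
  simp only [ContinuousLinearMap.comp_apply, scaledProj_apply]
  field_simp

end Sphere

section Transfer

variable {A B l a b c : ℝ} {P₀ : Fin 3 → ℝ} {ψ : ℝ × ℝ → Fin 3 → ℝ} {Q : ℝ × ℝ → ℝ × ℝ}
  {H : (Fin 3 → ℝ) → ℝ} {N Φ χ I : ℝ → ℝ}

lemma IsDarbouxChart.isPlanarDarbouxChart (hA : 0 < A) (hB : 0 < B) (hl : 0 < l)
    (hψ : IsDarbouxChart l ![√(2 * l), 0, 0] ψ) :
    IsPlanarDarbouxChart (density A B l ∘ transverseHalfSq A B) (scaledProj A B ∘ ψ) := by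
  have hpos : ∀ᶠ z in 𝓝 0, 0 < ψ z 0 := by
    have hcont : ContinuousAt (fun z => ψ z 0) 0 :=
      (continuous_apply 0).continuousAt.comp hψ.analyticAt.continuousAt
    refine hcont.eventually_const_lt ?_
    simp only [hψ.map_zero, Matrix.cons_val_zero]
    positivity
  refine ⟨((scaledProj A B).analyticAt _).comp hψ.analyticAt, ?_, ?_⟩
  · simp [hψ.map_zero, scaledProj_apply]
  · filter_upwards [hψ.analyticAt.eventually_analyticAt, hψ.mem_orbit.eventually_nhds,
      hψ.pullback_form, hpos] with z hz hcas hform hz0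
    rwa [orbitForm_fderiv_eq hA hB hz.differentiableAt hcas hz0] at hform

lemma IsPlanarDarbouxChart.isDarbouxChart (hA : 0 < A) (hB : 0 < B) (hl : 0 < l)
    (hQ : IsPlanarDarbouxChart (density A B l ∘ transverseHalfSq A B) Q) :
    IsDarbouxChart l ![√(2 * l), 0, 0] (scaledLift A B l ∘ Q) := by
  have hrad : ∀ᶠ z in 𝓝 0, 0 < 2 * l - 2 * transverseHalfSq A B (Q z) := by
    have hcont : ContinuousAt (fun w => 2 * l - 2 * transverseHalfSq A B w) 0 :=
      continuousAt_const.sub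
        (continuousAt_const.mul (analyticAt_transverseHalfSq A B 0).continuousAt)
    refine hQ.tendsto.eventually (hcont.eventually_const_lt ?_)
    simp only [transverseHalfSq_zero]
    linarith
  have hcas : ∀ᶠ z in 𝓝 0, casimir ((scaledLift A B l ∘ Q) z) = l :=
    hrad.mono fun z hz => casimir_scaledLift hA.le hB.le hz.le
  have hlift : AnalyticAt ℝ (scaledLift A B l ∘ Q) 0 :=
    (analyticAt_scaledLift A B hl).comp_of_eq hQ.analyticAt hQ.map_zero
  have hproj : scaledProj A B ∘ scaledLift A B l ∘ Q = Q :=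
    funext fun z => scaledProj_scaledLift hA hB l (Q z)
  refine ⟨hlift, ?_, hcas, ?_⟩
  · rw [Function.comp_apply, hQ.map_zero, scaledLift_zero]
  · filter_upwards [hlift.eventually_analyticAt, hcas.eventually_nhds, hrad, hQ.pullback_form]
      with z hz hcasz hradz hform
    rw [orbitForm_fderiv_eq hA hB hz.differentiableAt hcasz (Real.sqrt_pos.2 hradz), hproj,
      Function.comp_apply, scaledProj_scaledLift hA hB]
    exact hform

lemma IsBirkhoffNormalForm.isPlanarNormalForm (hba : b < a) (hca : c < a) (hl : 0 < l)
    (hN : IsBirkhoffNormalForm l (diagonalHamiltonian a b c) ![√(2 * l), 0, 0] N) :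
    IsPlanarNormalForm (density (a - b) (a - c) l ∘ transverseHalfSq (a - b) (a - c))
      (fun t => l * a - N t) := by
  obtain ⟨ψ, hψ, hNψ⟩ := hN.exists_chart
  refine ⟨analyticAt_const.sub hN.analyticAt, _,
    hψ.isPlanarDarbouxChart (sub_pos.2 hba) (sub_pos.2 hca) hl, ?_⟩
  filter_upwards [hψ.mem_orbit, hNψ] with z hcas hz
  rw [diagonalHamiltonian_eq_sub_halfSq hba.le hca.le hcas] at hz
  exact (sub_eq_iff_eq_add'.2 (sub_eq_iff_eq_add.1 hz)).symm

lemma IsPlanarNormalForm.isBirkhoffNormalForm (hba : b < a) (hca : c < a) (hl : 0 < l)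
    (hχ : IsPlanarNormalForm
      (density (a - b) (a - c) l ∘ transverseHalfSq (a - b) (a - c)) χ) (hχ' : deriv χ 0 ≠ 0) :
    IsBirkhoffNormalForm l (diagonalHamiltonian a b c) ![√(2 * l), 0, 0]
      (fun t => l * a - χ t) := by
  have hA := sub_pos.2 hba
  have hB := sub_pos.2 hca
  obtain ⟨Q, hQ, hχQ⟩ := hχ.exists_chart
  have hψ := hQ.isDarbouxChart hA hB hl
  refine ⟨analyticAt_const.sub hχ.analyticAt, ?_, _, hψ, ?_⟩
  · rwa [deriv_const_sub, neg_ne_zero]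
  · filter_upwards [hψ.mem_orbit, hχQ] with z hcas hz
    rw [diagonalHamiltonian_eq_sub_halfSq hba.le hca.le hcas, Function.comp_apply,
      scaledProj_scaledLift hA hB, hz, halfSq]

/-- The antipodal map reverses the symplectic form; the swap of the coordinates compensates. -/
lemma IsDarbouxChart.neg (hψ : IsDarbouxChart l P₀ ψ) :
    IsDarbouxChart l (-P₀) (fun z => -ψ z.swap) := by
  have hswap : Tendsto (Prod.swap : ℝ × ℝ → ℝ × ℝ) (𝓝 0) (𝓝 0) := continuous_swap.tendsto 0
  refine ⟨(hψ.analyticAt.comp_of_eq (analyticAt_snd.prod analyticAt_fst) rfl).neg, ?_, ?_, ?_⟩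
  · exact congrArg Neg.neg hψ.map_zero
  · filter_upwards [hswap.eventually hψ.mem_orbit] with z hz
    rw [casimir_neg, hz]
  · filter_upwards [hswap.eventually hψ.analyticAt.eventually_analyticAt,
      hswap.eventually hψ.pullback_form] with z hz hform
    have hfderiv := ((hz.differentiableAt.hasFDerivAt (x := z.swap)).comp z
      (ContinuousLinearEquiv.prodComm ℝ ℝ ℝ).hasFDerivAt).neg.fderiv
    have happly (v : ℝ × ℝ) : fderiv ℝ (fun z => -ψ z.swap) z v = -fderiv ℝ ψ z.swap v.swap :=
      congrArg (· v) hfderiv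
    rw [happly, happly, orbitForm_neg]
    exact hform

lemma IsInverseBirkhoffNormalForm.neg (hH : ∀ P, H (-P) = H P)
    (hΦ : IsInverseBirkhoffNormalForm l H P₀ Φ) : IsInverseBirkhoffNormalForm l H (-P₀) Φ := by
  obtain ⟨N, ⟨hN, hN', ψ, hψ, hNψ⟩, hΦN⟩ := hΦ
  refine ⟨N, ⟨hN, hN', _, hψ.neg, ?_⟩, hΦN⟩
  filter_upwards [(continuous_swap.tendsto (0 : ℝ × ℝ)).eventually hNψ] with z hz
  rw [hH, hz, Prod.fst_swap, Prod.snd_swap, add_comm]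

lemma IsInverseBirkhoffNormalForm.eventually_eq_action (hba : b < a) (hca : c < a) (hl : 0 < l)
    (hI : IsActionFunction (density (a - b) (a - c) l ∘ transverseHalfSq (a - b) (a - c)) I)
    (hΦ : IsInverseBirkhoffNormalForm l (diagonalHamiltonian a b c) ![√(2 * l), 0, 0] Φ) :
    ∀ᶠ h in 𝓝 (l * a), Φ h = I (l * a - h) := by
  obtain ⟨N, hN, hΦN, -⟩ := hΦ
  have hχ := hN.isPlanarNormalForm hba hca hl
  have hN0 : N 0 = l * a := (sub_eq_zero.1 hχ.map_zero).symm
  rw [← hN0, ← hN.analyticAt.hasStrictDerivAt.map_nhds_eq hN.deriv_ne_zero, eventually_map]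
  filter_upwards [hΦN, hχ.eventually_action_apply hI] with t hΦt hIt
  rw [hΦt, hN0, hIt]

lemma tendsto_const_sub_nhds_zero (x : ℝ) : Tendsto (fun y => x - y) (𝓝 x) (𝓝 0) := by
  simpa using (continuous_sub_left x).tendsto x

lemma IsActionFunction.isInverseBirkhoffNormalForm (hba : b < a) (hca : c < a) (hl : 0 < l)
    (hI : IsActionFunction (density (a - b) (a - c) l ∘ transverseHalfSq (a - b) (a - c)) I)
    (hI' : deriv I 0 ≠ 0) :
    IsInverseBirkhoffNormalForm l (diagonalHamiltonian a b c) ![√(2 * l), 0, 0]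
      (fun h => I (l * a - h)) := by
  obtain ⟨G, hG, hG0, hIG, hGI⟩ :=
    exists_analyticAt_localInverse_of_deriv_ne_zero hI.analyticAt hI'
  rw [hI.map_zero] at hG hG0 hIG
  have hG' : deriv G 0 ≠ 0 := by
    have hderiv : HasDerivAt (I ∘ G) (deriv I 0 * deriv G 0) 0 :=
      hI.analyticAt.differentiableAt.hasDerivAt.comp_of_eq 0 hG.differentiableAt.hasDerivAt hG0.symm
    exact right_ne_zero_of_mul_eq_one (hderiv.unique ((hasDerivAt_id 0).congr_of_eventuallyEq hIG))
  have hdensity : (density (a - b) (a - c) l ∘ transverseHalfSq (a - b) (a - c)) 0 ≠ 0 := by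
    rw [Function.comp_apply, transverseHalfSq_zero]
    exact (density_zero_pos (sub_pos.2 hba) (sub_pos.2 hca) hl).ne'
  refine ⟨_, (hI.isPlanarNormalForm hdensity hG hGI).isBirkhoffNormalForm hba hca hl hG', ?_, ?_⟩
  · simpa only [sub_sub_cancel] using hIG
  · rw [hG0, sub_zero]
    filter_upwards [(tendsto_const_sub_nhds_zero (l * a)).eventually hGI] with h hh
    rw [hh, sub_sub_cancel]

lemma exists_isActionFunction_meanDensity (hA : 0 < A) (hB : 0 < B) (hl : 0 < l) :
    ∃ I, IsActionFunction (density A B l ∘ transverseHalfSq A B) I ∧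
      ∀ᶠ s in 𝓝 0, HasDerivAt I (meanDensity A B l s) s :=
  exists_isActionFunction (analyticAt_density_comp_transverseHalfSq hA hB hl)
    (analyticAt_meanDensity hA hB hl) (meanDensity_zero A B l ▸ density_zero_pos hA hB hl)
    (.of_forall (rotMean_density A B l))

lemma exists_isInverseBirkhoffNormalForm (hba : b < a) (hca : c < a) (hl : 0 < l) :
    ∃ Φ, IsInverseBirkhoffNormalForm l (diagonalHamiltonian a b c) ![√(2 * l), 0, 0] Φ := by
  have hA := sub_pos.2 hba
  have hB := sub_pos.2 hca
  obtain ⟨I, hI, hderiv⟩ := exists_isActionFunction_meanDensity hA hB hl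
  refine ⟨_, hI.isInverseBirkhoffNormalForm hba hca hl ?_⟩
  rw [hderiv.self_of_nhds.deriv, meanDensity_zero]
  exact (density_zero_pos hA hB hl).ne'

lemma IsInverseBirkhoffNormalForm.eventually_hasDerivAt (hba : b < a) (hca : c < a) (hl : 0 < l)
    (hΦ : IsInverseBirkhoffNormalForm l (diagonalHamiltonian a b c) ![√(2 * l), 0, 0] Φ) :
    ∀ᶠ h in 𝓝 (l * a), HasDerivAt Φ (periodS l a b c (h / l)) h := by
  obtain ⟨I, hI, hderiv⟩ :=
    exists_isActionFunction_meanDensity (sub_pos.2 hba) (sub_pos.2 hca) hl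
  filter_upwards [(hΦ.eventually_eq_action hba hca hl hI).eventually_nhds,
    (tendsto_const_sub_nhds_zero (l * a)).eventually hderiv,
    eventually_gt_nhds (mul_lt_mul_of_pos_left hba hl),
    eventually_gt_nhds (mul_lt_mul_of_pos_left hca hl)] with h hΦI hIh hbh hch
  have hmean : -meanDensity (a - b) (a - c) l (l * a - h) = periodS l a b c (h / l) := by
    rw [neg_eq_iff_eq_neg, ← meanDensity_eq_neg_periodS hl hba hca ((lt_div_iff₀' hl).2 hbh)
      ((lt_div_iff₀' hl).2 hch), mul_sub, mul_div_cancel₀ h hl.ne']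
  exact hmean ▸ (HasDerivAt.comp_const_sub (l * a) h hIh).congr_of_eventuallyEq hΦI

end Transfer

end FreeRigidBody

theorem theorem4p1_general {a b c l : ℝ} (hba : b < a) (hca : c < a) (hl : 0 < l)
    {P₀ : Fin 3 → ℝ} (hP₀ : P₀ = ![√(2 * l), 0, 0] ∨ P₀ = ![-√(2 * l), 0, 0]) :
    (∃ Φ₁ : ℝ → ℝ, FreeRigidBody.IsInverseBirkhoffNormalForm l
      (FreeRigidBody.diagonalHamiltonian a b c) P₀ Φ₁) ∧
    ∀ Φ₁ : ℝ → ℝ,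
      FreeRigidBody.IsInverseBirkhoffNormalForm l
        (FreeRigidBody.diagonalHamiltonian a b c) P₀ Φ₁ →
      ∀ᶠ h in 𝓝 (l * a), HasDerivAt Φ₁ (FreeRigidBody.periodS l a b c (h / l)) h := by
  obtain ⟨Φ, hΦ⟩ := FreeRigidBody.exists_isInverseBirkhoffNormalForm hba hca hl
  have hsymm := FreeRigidBody.diagonalHamiltonian_neg a b c
  have hneg : ![-√(2 * l), 0, 0] = -![√(2 * l), 0, 0] := by simp
  rcases hP₀ with rfl | rfl
  · exact ⟨⟨Φ, hΦ⟩, fun Φ₁ hΦ₁ => hΦ₁.eventually_hasDerivAt hba hca hl⟩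
  · refine ⟨⟨Φ, hneg ▸ hΦ.neg hsymm⟩, fun Φ₁ hΦ₁ => ?_⟩
    rw [hneg] at hΦ₁
    exact (neg_neg ![√(2 * l), 0, 0] ▸ hΦ₁.neg hsymm).eventually_hasDerivAt hba hca hl

/-- At each of the equilibria `(±√(2l), 0, 0)` an inverse Birkhoff normal form `Φ₁` of the
Hamiltonian exists, and the derivative of any such `Φ₁` is `S(1/I₁, 1/I₂, 1/I₃, h/l)` for all
energies `h` near the critical value `l/I₁`. -/
theorem theorem4p1 (I₁ I₂ I₃ l : ℝ) (hI₁ : 0 < I₁) (hI₁₂ : I₁ < I₂) (hI₂₃ : I₂ < I₃)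
    (hl : 0 < l) (P₀ : Fin 3 → ℝ)
    (hP₀ : P₀ = ![√(2 * l), 0, 0] ∨ P₀ = ![-√(2 * l), 0, 0]) :
    (∃ Φ₁ : ℝ → ℝ, FreeRigidBody.IsInverseBirkhoffNormalForm l
      (FreeRigidBody.energy I₁ I₂ I₃) P₀ Φ₁) ∧
    ∀ Φ₁ : ℝ → ℝ,
      FreeRigidBody.IsInverseBirkhoffNormalForm l (FreeRigidBody.energy I₁ I₂ I₃) P₀ Φ₁ →
      ∀ᶠ h in 𝓝 (l / I₁),
        HasDerivAt Φ₁ (FreeRigidBody.periodS l (1 / I₁) (1 / I₂) (1 / I₃) (h / l)) h := by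
  rw [div_eq_mul_one_div l I₁, FreeRigidBody.energy_eq_diagonalHamiltonian]
  exact theorem4p1_general (one_div_lt_one_div_of_lt hI₁ hI₁₂)
    (one_div_lt_one_div_of_lt hI₁ (hI₁₂.trans hI₂₃)) hl hP₀
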